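/- Let $n\ge 1$ and $0<p,q\le\infty$. Fix a smooth function $\eta:\mathbb{R}^n\to[0,1]$ with $\eta(\xi)=1$ for $|\xi|_\infty\le 1/2$ and $\eta(\xi)=0$ for $|\xi|_\infty\ge 3/4$, put $\sigma_k(\xi)=\eta(\xi-k)\big(\sum_{l\in\mathbb{Z}^n}\eta(\xi-l)\big)^{-1}$ and $\Box_k=\mathscr{F}^{-1}\sigma_k\mathscr{F}$ for $k\in\mathbb{Z}^n$, and let the modulation space $M^{p,q}(\mathbb{R}^n)$ consist of all tempered distributions $f$ with $$\|f\|_{M^{p,q}}=\Big(\sum_{k\in\mathbb{Z}^n}\|\Box_kf\|_{L^p}^q\Big)^{1/q}<\infty$$ (the supremum over $k$ if $q=\infty$). Let $\Phi:\mathbb{R}^n\to\mathbb{C}$ be a measurable function with $$\int_{B(0,1)}|y|^n|\Phi(y)|\,dy<\infty,\qquad \int_{B(0,1)^c}|\Phi(y)|\,dy<\infty,$$ and let $H_\Phi$ be the Hausdorff operator $$H_\Phi f(x)=\int_{\mathbb{R}^n}\Phi(y)\,f\!\left(\frac{x}{|y|}\right)dy,$$ which maps Schwartz functions to tempered distributions.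 If $p<1$ or $q<1$, then $$H_\Phi\text{ is bounded on }M^{p,q}(\mathbb{R}^n)\iff H_\Phi=0.$$ Here "bounded on $M^{p,q}$" means that there is a constant $C$ with $\|H_\Phi f\|_{M^{p,q}}\le C\|f\|_{M^{p,q}}$ for all Schwartz functions $f$, and $H_\Phi=0$ means $H_\Phi f=0$ for all Schwartz functions $f$; the same equivalence holds if "bounded on $M^{p,q}$" is taken to mean that $H_\Phi$ extends from the Schwartz functions to a bounded linear operator on $M^{p,q}$. -/

import Mathlib

open MeasureTheory SchwartzMap
open scoped ENNReal NNReal ContDiff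

noncomputable section

namespace HausdorffModulation

/-- `ℝⁿ` with the Euclidean norm. -/
abbrev Rn (n : ℕ) : Type := EuclideanSpace ℝ (Fin n)

/-! ### The Hausdorff operator -/

/-- `H_Φ f (x) = ∫ Φ(y) f(x / |y|) dy`. -/
def hausdorffFun {n : ℕ} (Φ : Rn n → ℂ) (f : Rn n → ℂ) (x : Rn n) : ℂ :=
  ∫ y : Rn n, Φ y * f (‖y‖⁻¹ • x)

/-- `Φ` is (Lebesgue) measurable, `|y|ⁿ Φ(y)` is integrable on the unit ball and `Φ` is integrable
on its complement. -/
structure IsHausdorffKernel {n : ℕ} (Φ : Rn n → ℂ) : Prop where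
  aestronglyMeasurable : AEStronglyMeasurable Φ volume
  integrableOn_ball : IntegrableOn (fun y => ((‖y‖ ^ n : ℝ) : ℂ) * Φ y) (Metric.ball 0 1)
  integrableOn_compl : IntegrableOn Φ (Metric.ball 0 1)ᶜ

/-- The pairing `∫∫ g(x) Φ(y) f(x/|y|) dy dx` converges absolutely for Schwartz `f`, `g`, and is
controlled by the `L¹` and `L^∞` norms of `f` and `g`. -/
theorem IsHausdorffKernel.exists_bound {n : ℕ} [NeZero n] {Φ : Rn n → ℂ}
    (hΦ : IsHausdorffKernel Φ) :
    ∃ A : ℝ, 0 ≤ A ∧ ∀ f g : 𝓢(Rn n, ℂ),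
      Integrable (fun z : Rn n × Rn n => g z.1 * (Φ z.2 * f (‖z.2‖⁻¹ • z.1)))
        (volume.prod volume) ∧
      ‖∫ z : Rn n × Rn n, g z.1 * (Φ z.2 * f (‖z.2‖⁻¹ • z.1)) ∂(volume.prod volume)‖ ≤
        A * ((∫ x, ‖f x‖) * ‖toBoundedContinuousFunctionCLM ℂ (Rn n) ℂ g‖ +
          ‖toBoundedContinuousFunctionCLM ℂ (Rn n) ℂ f‖ * ∫ x, ‖g x‖) := by
  set B : Set (Rn n) := Metric.ball 0 1 with hB
  have hBm : MeasurableSet B := measurableSet_ball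
  have hi1 : Integrable (B.indicator fun y => ‖y‖ ^ n * ‖Φ y‖) := by
    rw [integrable_indicator_iff hBm]
    refine hΦ.integrableOn_ball.norm.congr (Filter.Eventually.of_forall fun y => ?_)
    simp
  have hi2 : Integrable (Bᶜ.indicator fun y => ‖Φ y‖) := by
    rw [integrable_indicator_iff hBm.compl]
    exact hΦ.integrableOn_compl.norm
  set w : Rn n → ℝ := fun y =>
    (B.indicator fun y => ‖y‖ ^ n * ‖Φ y‖) y + (Bᶜ.indicator fun y => ‖Φ y‖) y with hw
  have hwi : Integrable w := hi1.add hi2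
  have hw0 : ∀ y, 0 ≤ w y := fun y => by
    refine add_nonneg (Set.indicator_nonneg (fun y _ => by positivity) y)
      (Set.indicator_nonneg (fun y _ => by positivity) y)
  refine ⟨∫ y, w y, integral_nonneg hw0, fun f g => ?_⟩
  set Mf := ‖toBoundedContinuousFunctionCLM ℂ (Rn n) ℂ f‖
  set Mg := ‖toBoundedContinuousFunctionCLM ℂ (Rn n) ℂ g‖
  have hMf : ∀ x, ‖f x‖ ≤ Mf := fun x => by
    simpa using (toBoundedContinuousFunctionCLM ℂ (Rn n) ℂ f).norm_coe_le_norm x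
  have hMg : ∀ x, ‖g x‖ ≤ Mg := fun x => by
    simpa using (toBoundedContinuousFunctionCLM ℂ (Rn n) ℂ g).norm_coe_le_norm x
  have hMf0 : 0 ≤ Mf := norm_nonneg _
  have hMg0 : 0 ≤ Mg := norm_nonneg _
  have hfi : Integrable (fun x => ‖f x‖) := f.integrable.norm
  have hgi : Integrable (fun x => ‖g x‖) := g.integrable.norm
  have hI0 : 0 ≤ ∫ x, ‖f x‖ := integral_nonneg fun _ => norm_nonneg _
  have hJ0 : 0 ≤ ∫ x, ‖g x‖ := integral_nonneg fun _ => norm_nonneg _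
  set K := (∫ x, ‖f x‖) * Mg + Mf * ∫ x, ‖g x‖ with hK
  have hdil : Measurable fun z : Rn n × Rn n => f (‖z.2‖⁻¹ • z.1) :=
    f.continuous.measurable.comp (by fun_prop)
  have hmeas : AEStronglyMeasurable
      (fun z : Rn n × Rn n => g z.1 * (Φ z.2 * f (‖z.2‖⁻¹ • z.1)))
      (volume.prod volume) := by
    refine AEStronglyMeasurable.mul ?_ (AEStronglyMeasurable.mul ?_ ?_)
    · exact (g.continuous.comp continuous_fst).aestronglyMeasurable
    · exact hΦ.aestronglyMeasurable.comp_snd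
    · exact hdil.aestronglyMeasurable
  have hslice : ∀ y : Rn n, Integrable fun x => g x * f (‖y‖⁻¹ • x) := by
    intro y
    refine g.integrable.mul_bdd (c := Mf) ?_ (Filter.Eventually.of_forall fun x => hMf _)
    exact (f.continuous.comp (continuous_const_smul _)).aestronglyMeasurable
  have hfac : ∀ y x : Rn n,
      g x * (Φ y * f (‖y‖⁻¹ • x)) = Φ y * (g x * f (‖y‖⁻¹ • x)) := fun y x => by ring
  have hb1 : ∀ y : Rn n, ∫ x, ‖g x * f (‖y‖⁻¹ • x)‖ ≤ K := by
    intro y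
    calc ∫ x, ‖g x * f (‖y‖⁻¹ • x)‖ ≤ ∫ x, ‖g x‖ * Mf := by
          refine integral_mono (hslice y).norm (hgi.mul_const _) fun x => ?_
          simp only [norm_mul]
          exact mul_le_mul_of_nonneg_left (hMf _) (norm_nonneg _)
      _ = Mf * ∫ x, ‖g x‖ := by rw [integral_mul_const, mul_comm]
      _ ≤ K := by rw [hK]; nlinarith [mul_nonneg hI0 hMg0]
  have hb2 : ∀ y : Rn n, y ≠ 0 → ∫ x, ‖g x * f (‖y‖⁻¹ • x)‖ ≤ ‖y‖ ^ n * K := by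
    intro y hy
    have hy' : ‖y‖⁻¹ ≠ 0 := inv_ne_zero (norm_ne_zero_iff.2 hy)
    have hdi : Integrable fun x => ‖f (‖y‖⁻¹ • x)‖ := hfi.comp_smul hy'
    calc ∫ x, ‖g x * f (‖y‖⁻¹ • x)‖ ≤ ∫ x, Mg * ‖f (‖y‖⁻¹ • x)‖ := by
          refine integral_mono (hslice y).norm (hdi.const_mul _) fun x => ?_
          simp only [norm_mul]
          exact mul_le_mul_of_nonneg_right (hMg _) (norm_nonneg _)
      _ = ‖y‖ ^ n * ((∫ x, ‖f x‖) * Mg) := by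
          rw [integral_const_mul,
            Measure.integral_comp_inv_smul_of_nonneg volume (fun x => ‖f x‖) (norm_nonneg y)]
          simp only [finrank_euclideanSpace, Fintype.card_fin, smul_eq_mul]
          ring
      _ ≤ ‖y‖ ^ n * K := by
          refine mul_le_mul_of_nonneg_left ?_ (by positivity)
          rw [hK]; nlinarith [mul_nonneg hMf0 hJ0]
  have hbound : ∀ᵐ y : Rn n, ∫ x, ‖g x * (Φ y * f (‖y‖⁻¹ • x))‖ ≤ w y * K := by
    have hne : ∀ᵐ y : Rn n, y ≠ 0 := by
      have : Nonempty (Fin n) := ⟨0⟩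
      exact Measure.ae_ne volume 0
    filter_upwards [hne] with y hy
    have hcalc : ∫ x, ‖g x * (Φ y * f (‖y‖⁻¹ • x))‖ =
        ‖Φ y‖ * ∫ x, ‖g x * f (‖y‖⁻¹ • x)‖ := by
      rw [← integral_const_mul]
      refine integral_congr_ae (Filter.Eventually.of_forall fun x => ?_)
      simp only [hfac y x, norm_mul]
    rw [hcalc]
    by_cases hyB : y ∈ B
    · have : w y = ‖y‖ ^ n * ‖Φ y‖ := by simp [hw, hyB]
      rw [this]
      calc _ ≤ ‖Φ y‖ * (‖y‖ ^ n * K) := mul_le_mul_of_nonneg_left (hb2 y hy) (norm_nonneg _)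
        _ = _ := by ring
    · have : w y = ‖Φ y‖ := by simp [hw, hyB]
      rw [this]
      exact mul_le_mul_of_nonneg_left (hb1 y) (norm_nonneg _)
  have hwK : Integrable fun y => w y * K := hwi.mul_const _
  have hint : Integrable (fun z : Rn n × Rn n => g z.1 * (Φ z.2 * f (‖z.2‖⁻¹ • z.1)))
      (volume.prod volume) := by
    rw [integrable_prod_iff' hmeas]
    refine ⟨Filter.Eventually.of_forall fun y => ?_, ?_⟩
    · simp only [hfac y]
      exact (hslice y).const_mul _
    · refine hwK.mono' hmeas.norm.prod_swap.integral_prod_right' ?_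
      filter_upwards [hbound] with y hy
      rw [Real.norm_of_nonneg (integral_nonneg fun _ => norm_nonneg _)]
      exact hy
  refine ⟨hint, ?_⟩
  calc _ ≤ ∫ z : Rn n × Rn n, ‖g z.1 * (Φ z.2 * f (‖z.2‖⁻¹ • z.1))‖ ∂(volume.prod volume) :=
        norm_integral_le_integral_norm _
    _ = ∫ y : Rn n, ∫ x : Rn n, ‖g x * (Φ y * f (‖y‖⁻¹ • x))‖ :=
        integral_prod_symm _ hint.norm
    _ ≤ ∫ y, w y * K := integral_mono_ae hint.norm.integral_prod_right hwK hbound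
    _ = (∫ y, w y) * K := integral_mul_const _ _

theorem IsHausdorffKernel.integral_mul_hausdorffFun {n : ℕ} [NeZero n] {Φ : Rn n → ℂ}
    (hΦ : IsHausdorffKernel Φ) (f g : 𝓢(Rn n, ℂ)) :
    ∫ x, g x * hausdorffFun Φ f x =
      ∫ z : Rn n × Rn n, g z.1 * (Φ z.2 * f (‖z.2‖⁻¹ • z.1)) ∂(volume.prod volume) := by
  obtain ⟨A, -, hA⟩ := hΦ.exists_bound
  rw [integral_prod _ (hA f g).1]
  simp only [integral_const_mul, hausdorffFun]

/-- For Schwartz `f`, the function `H_Φ f` as the tempered distribution `g ↦ ∫ g(x) H_Φ f(x) dx`. -/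
def hausdorffDistribution {n : ℕ} [NeZero n] {Φ : Rn n → ℂ} (hΦ : IsHausdorffKernel Φ)
    (f : 𝓢(Rn n, ℂ)) : 𝓢'(Rn n, ℂ) :=
  ContinuousLinearMap.toPointwiseConvergenceCLM _ _ _ _
    { toFun := fun g => ∫ x, g x * hausdorffFun Φ f x
      map_add' := fun g₁ g₂ => by
        obtain ⟨A, -, hA⟩ := hΦ.exists_bound
        simp only [hΦ.integral_mul_hausdorffFun]
        rw [← integral_add (hA f g₁).1 (hA f g₂).1]
        simp only [add_apply, add_mul]
      map_smul' := fun c g => by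
        simp only [smul_apply, smul_eq_mul, mul_assoc, integral_const_mul,
          RingHom.id_apply]
      cont := by
        obtain ⟨A, hA0, hA⟩ := hΦ.exists_bound
        let L : 𝓢(Rn n, ℂ) →+ ℂ :=
          { toFun := fun g => ∫ x, g x * hausdorffFun Φ f x
            map_zero' := by simp
            map_add' := fun g₁ g₂ => by
              simp only [hΦ.integral_mul_hausdorffFun]
              rw [← integral_add (hA f g₁).1 (hA f g₂).1]
              simp only [add_apply, add_mul] }
        change Continuous L
        refine continuous_of_continuousAt_zero L ?_
        rw [ContinuousAt, map_zero]
        have hcont : Continuous fun g : 𝓢(Rn n, ℂ) =>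
            A * ((∫ x, ‖f x‖) * ‖toBoundedContinuousFunctionCLM ℂ (Rn n) ℂ g‖ +
              ‖toBoundedContinuousFunctionCLM ℂ (Rn n) ℂ f‖ * ‖toLpCLM ℂ ℂ 1 volume g‖) := by
          have h1 := (toBoundedContinuousFunctionCLM ℂ (Rn n) ℂ).continuous.norm
          have h2 := (toLpCLM ℂ ℂ 1 (volume : Measure (Rn n))).continuous.norm
          exact continuous_const.mul ((continuous_const.mul h1).add (continuous_const.mul h2))
        refine squeeze_zero_norm (a := fun g : 𝓢(Rn n, ℂ) =>
            A * ((∫ x, ‖f x‖) * ‖toBoundedContinuousFunctionCLM ℂ (Rn n) ℂ g‖ +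
              ‖toBoundedContinuousFunctionCLM ℂ (Rn n) ℂ f‖ * ‖toLpCLM ℂ ℂ 1 volume g‖))
          (fun g => ?_) ?_
        · have h := (hA f g).2
          rw [← hΦ.integral_mul_hausdorffFun] at h
          rw [toLpCLM_apply, norm_toLp_one]
          exact h
        · have h0 := hcont.tendsto 0
          simpa only [map_zero, norm_zero, mul_zero, add_zero] using h0 }

theorem hausdorffDistribution_apply {n : ℕ} [NeZero n] {Φ : Rn n → ℂ}
    (hΦ : IsHausdorffKernel Φ) (f g : 𝓢(Rn n, ℂ)) :
    hausdorffDistribution hΦ f g = ∫ x, g x * hausdorffFun Φ f x := rfl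

/-- The Hausdorff operator `H_Φ` as a linear operator from Schwartz functions to tempered
distributions. -/
def hausdorffOp {n : ℕ} [NeZero n] {Φ : Rn n → ℂ} (hΦ : IsHausdorffKernel Φ) :
    𝓢(Rn n, ℂ) →ₗ[ℂ] 𝓢'(Rn n, ℂ) where
  toFun := hausdorffDistribution hΦ
  map_add' f₁ f₂ := by
    obtain ⟨A, -, hA⟩ := hΦ.exists_bound
    ext g
    change hausdorffDistribution hΦ (f₁ + f₂) g =
      hausdorffDistribution hΦ f₁ g + hausdorffDistribution hΦ f₂ g
    simp only [hausdorffDistribution_apply, hΦ.integral_mul_hausdorffFun]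
    rw [← integral_add (hA f₁ g).1 (hA f₂ g).1]
    simp only [add_apply, mul_add]
  map_smul' c f := by
    ext g
    change hausdorffDistribution hΦ (c • f) g = c * hausdorffDistribution hΦ f g
    simp only [hausdorffDistribution_apply, hΦ.integral_mul_hausdorffFun]
    rw [← integral_const_mul]
    simp only [smul_apply, smul_eq_mul]
    congr 1
    ext z
    ring

/-! ### Modulation spaces -/

/-- The lattice point `k ∈ ℤⁿ` as a vector of `ℝⁿ`. -/
def latticePoint {n : ℕ} (k : Fin n → ℤ) : Rn n := WithLp.toLp 2 fun i => (k i : ℝ)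

/-- `η : ℝⁿ → [0,1]` is smooth, equal to `1` for `|ξ|_∞ ≤ 1/2` and to `0` for `|ξ|_∞ ≥ 3/4`. -/
structure IsWindow {n : ℕ} (η : Rn n → ℝ) : Prop where
  contDiff : ContDiff ℝ ∞ η
  mem_Icc : ∀ ξ, η ξ ∈ Set.Icc (0 : ℝ) 1
  eq_one : ∀ ξ, (∀ i, |ξ i| ≤ 1 / 2) → η ξ = 1
  eq_zero : ∀ ξ, (∃ i, 3 / 4 ≤ |ξ i|) → η ξ = 0

/-- `σ_k(ξ) = η(ξ - k) (∑_{l ∈ ℤⁿ} η(ξ - l))⁻¹`; for a window `η` the sum is locally finite and at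
least `1`. -/
def partitionFun {n : ℕ} (η : Rn n → ℝ) (k : Fin n → ℤ) (ξ : Rn n) : ℝ :=
  η (ξ - latticePoint k) * (∑' l : Fin n → ℤ, η (ξ - latticePoint l))⁻¹

/-- The frequency-uniform decomposition operator `□_k = 𝓕⁻¹ σ_k 𝓕` on tempered distributions. -/
def boxOp {n : ℕ} (η : Rn n → ℝ) (k : Fin n → ℤ) : 𝓢'(Rn n, ℂ) →L[ℂ] 𝓢'(Rn n, ℂ) :=
  TemperedDistribution.fourierMultiplierCLM ℂ fun ξ => (partitionFun η k ξ : ℂ)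

/-- The tempered distribution `u` is given by the function `h`. -/
def IsGivenBy {n : ℕ} (u : 𝓢'(Rn n, ℂ)) (h : Rn n → ℂ) : Prop :=
  ∀ g : 𝓢(Rn n, ℂ), Integrable (fun x => g x * h x) ∧ u g = ∫ x, g x * h x

/-- The `L^p` (quasi-)norm of a tempered distribution: that of the function which it is given by
(unique almost everywhere), and `∞` if there is none. -/
def distLpNorm {n : ℕ} (p : ℝ≥0∞) (u : 𝓢'(Rn n, ℂ)) : ℝ≥0∞ :=
  ⨅ (h : Rn n → ℂ) (_ : IsGivenBy u h), eLpNorm h p volume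

/-- The `ℓ^q` (quasi-)norm of a family of elements of `[0,∞]`, for `0 < q ≤ ∞`. -/
def lqNorm {ι : Type*} (q : ℝ≥0∞) (a : ι → ℝ≥0∞) : ℝ≥0∞ :=
  if q = ⊤ then ⨆ i, a i else (∑' i, a i ^ q.toReal) ^ (1 / q.toReal)

/-- The (quasi-)norm of `M^{p,q}(ℝⁿ)`; the space consists of the tempered distributions for which it
is finite. -/
def modulationNorm {n : ℕ} (η : Rn n → ℝ) (p q : ℝ≥0∞) (u : 𝓢'(Rn n, ℂ)) : ℝ≥0∞ :=
  lqNorm q fun k : Fin n → ℤ => distLpNorm p (boxOp η k u)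

/-- `u ∈ M^{p,q}(ℝⁿ)`. -/
def MemModulation {n : ℕ} (η : Rn n → ℝ) (p q : ℝ≥0∞) (u : 𝓢'(Rn n, ℂ)) : Prop :=
  modulationNorm η p q u < ⊤

/-! ### Boundedness -/

/-- `‖H f‖_{M^{p,q}} ≤ C ‖f‖_{M^{p,q}}` for all Schwartz functions `f`. -/
def IsBoundedOnModulation {n : ℕ} (η : Rn n → ℝ) (p q : ℝ≥0∞)
    (H : 𝓢(Rn n, ℂ) →ₗ[ℂ] 𝓢'(Rn n, ℂ)) : Prop :=
  ∃ C : ℝ≥0, ∀ f : 𝓢(Rn n, ℂ),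
    modulationNorm η p q (H f) ≤
      C * modulationNorm η p q (toTemperedDistributionCLM (Rn n) ℂ volume f)

/-- `H` extends from Schwartz functions to a bounded linear operator on all of `M^{p,q}`.
Every linear operator on the subspace `M^{p,q}` is the restriction of a linear
operator `T` on the tempered distributions, whose values off `M^{p,q}` play no role here. -/
def HasBoundedExtension {n : ℕ} (η : Rn n → ℝ) (p q : ℝ≥0∞)
    (H : 𝓢(Rn n, ℂ) →ₗ[ℂ] 𝓢'(Rn n, ℂ)) : Prop :=
  ∃ T : 𝓢'(Rn n, ℂ) →ₗ[ℂ] 𝓢'(Rn n, ℂ),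
    (∀ f : 𝓢(Rn n, ℂ), T (toTemperedDistributionCLM (Rn n) ℂ volume f) = H f) ∧
    ∃ C : ℝ≥0, ∀ u : 𝓢'(Rn n, ℂ), MemModulation η p q u →
      modulationNorm η p q (T u) ≤ C * modulationNorm η p q u

end HausdorffModulation

end

/-!
If `f` is concentrated near `a` and `g` near `b`, then `⟨H_Φ f, g⟩` only sees those dilations by
`|y|` which bring `a` close to `b`. Under the assumptions on `Φ` their total contribution tends to
`0` when `|a| + |b|` tends to infinity.

For `p < 1` take `f` to be a fixed band-limited profile translated by `N z`, and `g` an increasingly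
wide dilate `w(·/N)` whose frequencies lie in the box `k = 0`. Interpolating `L¹` between `L^∞` and
`L^p`, `|⟨H_Φ f, g⟩|` is at most `sup ^ (1 - p)` times a factor which stays bounded if `H_Φ` is
bounded on `M^{p,q}`. The supremum tends to `0` by the first paragraph, so the pairings do too,
although without any boundedness assumption they converge to a nonzero multiple of the transpose of
`H_Φ` applied to `w`, evaluated at `z`. Hence this transpose vanishes.

For `q < 1` the roles of position and frequency are exchanged: `H_Φ` is essentially intertwined with
its transpose by the Fourier transform, the profile is modulated instead of translated, and `ℓ¹` is
interpolated between `ℓ^∞` and `ℓ^q` over the boxes.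
-/

noncomputable section

open Filter Topology FourierTransform

namespace HausdorffModulation

/-! ### Schwartz functions -/

section Schwartz

variable {E : Type*} [NormedAddCommGroup E] [NormedSpace ℝ E]

/-- A smooth compactly supported real function as a complex-valued Schwartz function. -/
def ofRealSchwartz {φ : E → ℝ} (hφ : ContDiff ℝ ∞ φ) (hc : HasCompactSupport φ) : 𝓢(E, ℂ) :=
  HasCompactSupport.toSchwartzMap (f := fun x => (φ x : ℂ))
    (hc.comp_left Complex.ofReal_zero) (Complex.ofRealCLM.contDiff.comp hφ)

@[simp] theorem ofRealSchwartz_apply {φ : E → ℝ} (hφ : ContDiff ℝ ∞ φ) (hc : HasCompactSupport φ)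
    (x : E) : ofRealSchwartz hφ hc x = φ x := rfl

/-- The dilate `x ↦ f (c x)` of a Schwartz function. -/
def dilate (c : ℝ) (hc : c ≠ 0) (f : 𝓢(E, ℂ)) : 𝓢(E, ℂ) :=
  compCLMOfContinuousLinearEquiv ℂ
    (ContinuousLinearEquiv.smulLeft (R₁ := ℝ) (M₁ := E) (Units.mk0 c hc)) f

@[simp] theorem dilate_apply (c : ℝ) (hc : c ≠ 0) (f : 𝓢(E, ℂ)) (x : E) :
    dilate c hc f x = f (c • x) := rfl

theorem hasCompactSupport_dilate {f : 𝓢(E, ℂ)} (hf : HasCompactSupport f) (c : ℝ) (hc : c ≠ 0) :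
    HasCompactSupport (dilate c hc f) :=
  HasCompactSupport.comp_smul (f := f) hf hc

theorem exists_decay_compSubConst (f : 𝓢(E, ℂ)) (m : ℕ) :
    ∃ C : ℝ, 0 ≤ C ∧ ∀ a x, (1 + ‖x - a‖) ^ m * ‖compSubConstCLM ℂ a f x‖ ≤ C := by
  refine ⟨2 ^ m * (Finset.Iic (m, 0)).sup (fun m => SchwartzMap.seminorm ℂ m.1 m.2) f,
    by positivity, fun a x => ?_⟩
  simpa using one_add_le_sup_seminorm_apply (𝕜 := ℂ) (m := (m, 0)) le_rfl le_rfl f (x - a)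

theorem exists_decay (f : 𝓢(E, ℂ)) (m : ℕ) :
    ∃ C : ℝ, 0 ≤ C ∧ ∀ x, (1 + ‖x‖) ^ m * ‖f x‖ ≤ C := by
  obtain ⟨C, hC, h⟩ := exists_decay_compSubConst f m
  exact ⟨C, hC, fun x => by simpa using h 0 x⟩

variable [FiniteDimensional ℝ E]

/-- A smooth bump as a Schwartz function. -/
def bumpSchwartz {c : E} (b : ContDiffBump c) : 𝓢(E, ℂ) :=
  ofRealSchwartz b.contDiff b.hasCompactSupport

theorem bumpSchwartz_eq_one {c x : E} (b : ContDiffBump c) (hx : x ∈ Metric.closedBall c b.rIn) :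
    bumpSchwartz b x = 1 := by
  rw [bumpSchwartz, ofRealSchwartz_apply, b.one_of_mem_closedBall hx, Complex.ofReal_one]

theorem mem_ball_of_bumpSchwartz_ne_zero {c x : E} {b : ContDiffBump c}
    (h : bumpSchwartz b x ≠ 0) : x ∈ Metric.ball c b.rOut := by
  rw [← b.support_eq]
  exact Complex.ofReal_ne_zero.1 h

theorem norm_bumpSchwartz_le_one {c : E} (b : ContDiffBump c) (x : E) :
    ‖bumpSchwartz b x‖ ≤ 1 := by
  rw [bumpSchwartz, ofRealSchwartz_apply, Complex.norm_real, Real.norm_of_nonneg b.nonneg]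
  exact b.le_one

theorem hasCompactSupport_bumpSchwartz {c : E} (b : ContDiffBump c) :
    HasCompactSupport (bumpSchwartz b) :=
  b.hasCompactSupport.comp_left Complex.ofReal_zero

theorem exists_seq_hasCompactSupport (f : 𝓢(E, ℂ)) :
    ∃ u : ℕ → 𝓢(E, ℂ), (∀ j, HasCompactSupport (u j)) ∧ (∀ j x, ‖u j x‖ ≤ ‖f x‖) ∧
      ∀ x, ∀ᶠ j in atTop, u j x = f x := by
  let b (j : ℕ) : ContDiffBump (0 : E) := ⟨j + 1, j + 2, by positivity, by linarith⟩
  have happly : ∀ j x, smulLeftCLM ℂ (bumpSchwartz (b j)) f x = bumpSchwartz (b j) x * f x :=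
    fun j x => smulLeftCLM_apply_apply (bumpSchwartz (b j)).hasTemperateGrowth f x
  refine ⟨fun j => smulLeftCLM ℂ (bumpSchwartz (b j)) f, fun j => ?_, fun j x => ?_, fun x => ?_⟩
  · rw [show ⇑(smulLeftCLM ℂ (bumpSchwartz (b j)) f) = bumpSchwartz (b j) * f from
      funext (happly j)]
    exact (hasCompactSupport_bumpSchwartz (b j)).mul_right
  · rw [happly, norm_mul]
    exact mul_le_of_le_one_left (norm_nonneg _) (norm_bumpSchwartz_le_one _ _)
  · obtain ⟨j₀, hj₀⟩ := exists_nat_ge ‖x‖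
    filter_upwards [eventually_ge_atTop j₀] with j hj
    have hx : ‖x‖ ≤ (b j).rIn := hj₀.trans ((Nat.cast_le.2 hj).trans (by simp [b]))
    rw [happly, bumpSchwartz_eq_one _ (mem_closedBall_zero_iff.2 hx), one_mul]

end Schwartz

section Fourier

variable {E : Type*} [NormedAddCommGroup E] [InnerProductSpace ℝ E] [FiniteDimensional ℝ E]
  [MeasurableSpace E] [BorelSpace E]

theorem integral_bumpSchwartz_ne_zero {c : E} (b : ContDiffBump c) :
    ∫ x, bumpSchwartz b x ≠ 0 := by
  simp only [bumpSchwartz, ofRealSchwartz_apply]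
  rw [integral_complex_ofReal]
  exact Complex.ofReal_ne_zero.2 (b.integral_pos (μ := volume)).ne'

theorem integral_eq_pow_smul_integral_comp_smul {G : Type*} [NormedAddCommGroup G]
    [NormedSpace ℝ G] (F : E → G) {r : ℝ} (hr : 0 < r) :
    ∫ x, F x = r ^ Module.finrank ℝ E • ∫ x, F (r • x) := by
  rw [Measure.integral_comp_smul_of_nonneg volume F r (hR := hr.le), smul_smul,
    mul_inv_cancel₀ (by positivity), one_smul]

theorem fourier_dilate_apply {c : ℝ} (hc : 0 < c) (f : 𝓢(E, ℂ)) (ξ : E) :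
    𝓕 (dilate c hc.ne' f) ξ = ((c ^ Module.finrank ℝ E)⁻¹ : ℝ) • 𝓕 f (c⁻¹ • ξ) := by
  rw [fourier_coe, fourier_coe, Real.fourier_eq, Real.fourier_eq,
    integral_eq_pow_smul_integral_comp_smul (fun v => Real.fourierChar (-inner ℝ v (c⁻¹ • ξ)) • f v)
      hc, smul_smul, inv_mul_cancel₀ (by positivity), one_smul]
  simp only [inner_smul_left, inner_smul_right, dilate_apply, conj_trivial,
    inv_mul_cancel_left₀ hc.ne']

theorem fourier_pow_smul_dilate {c : ℝ} (hc : 0 < c) (f : 𝓢(E, ℂ)) :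
    𝓕 (c ^ Module.finrank ℝ E • dilate c hc.ne' f) = dilate c⁻¹ (inv_pos.2 hc).ne' (𝓕 f) := by
  ext ξ
  rw [← Complex.coe_smul, FourierTransform.fourier_smul, Complex.coe_smul, smul_apply,
    fourier_dilate_apply hc, dilate_apply, smul_smul, mul_inv_cancel₀ (by positivity), one_smul]

theorem fourier_compSubConst_apply (f : 𝓢(E, ℂ)) (a ξ : E) :
    𝓕 (compSubConstCLM ℂ a f) ξ = Real.fourierChar (-inner ℝ a ξ) • 𝓕 f ξ := by
  rw [fourier_coe, fourier_coe, Real.fourier_eq, Real.fourier_eq,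
    ← integral_sub_right_eq_self _ (-a)]
  simp only [Circle.smul_def]
  rw [← integral_smul]
  refine integral_congr_ae (Eventually.of_forall fun v => ?_)
  simp only [compSubConstCLM_apply, sub_neg_eq_add, add_sub_cancel_right, inner_add_left, neg_add]
  rw [AddChar.map_add_eq_mul, mul_comm, Circle.coe_mul, mul_smul]

theorem norm_fourier_compSubConst_apply (f : 𝓢(E, ℂ)) (a ξ : E) :
    ‖𝓕 (compSubConstCLM ℂ a f) ξ‖ = ‖𝓕 f ξ‖ := by
  rw [fourier_compSubConst_apply, Circle.norm_smul]

theorem fourierInv_apply (f : 𝓢(E, ℂ)) (x : E) : 𝓕⁻ f x = 𝓕 f (-x) := by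
  rw [fourierInv_coe, fourier_coe, Real.fourierInv_eq_fourier_neg]

theorem norm_fourierInv_compSubConst_apply (f : 𝓢(E, ℂ)) (a x : E) :
    ‖𝓕⁻ (compSubConstCLM ℂ a f) x‖ = ‖𝓕⁻ f x‖ := by
  rw [fourierInv_apply, fourierInv_apply, norm_fourier_compSubConst_apply]

theorem fourierInv_smulLeft_eq_convolution (χ f : 𝓢(E, ℂ)) :
    𝓕⁻ (smulLeftCLM ℂ χ f) =
      SchwartzMap.convolution (ContinuousLinearMap.mul ℂ ℂ) (𝓕⁻ χ) (𝓕⁻ f) := by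
  have hpair : smulLeftCLM ℂ χ f = pairing (ContinuousLinearMap.mul ℂ ℂ) χ f := by
    ext y
    rw [smulLeftCLM_apply_apply χ.hasTemperateGrowth, pairing_apply_apply]
    rfl
  have h := fourier_convolution (ContinuousLinearMap.mul ℂ ℂ) (𝓕⁻ χ : 𝓢(E, ℂ)) (𝓕⁻ f)
  simp only [FourierTransform.fourier_fourierInv_eq] at h
  rw [hpair, ← h, FourierTransform.fourierInv_fourier_eq]

theorem fourier_smulLeft_apply (χ f : 𝓢(E, ℂ)) (x : E) :
    𝓕 (smulLeftCLM ℂ χ f) x = ∫ s, 𝓕 χ (x - s) * 𝓕 f s := by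
  rw [← neg_neg x, ← fourierInv_apply, fourierInv_smulLeft_eq_convolution,
    SchwartzMap.convolution_apply, MeasureTheory.convolution,
    ← integral_sub_left_eq_self (fun s => 𝓕 χ (- -x - s) * 𝓕 f s) volume (- -x),
    ← integral_neg_eq_self]
  refine integral_congr_ae (Eventually.of_forall fun s => ?_)
  simp only [ContinuousLinearMap.mul_apply', fourierInv_apply]
  congr 2 <;> abel_nf

theorem integral_fourier_mul_comp_inv_smul (f g : 𝓢(E, ℂ)) {r : ℝ} (hr : 0 < r) :
    ∫ x, 𝓕 g x * f (r⁻¹ • x) = ∫ x, 𝓕 f x * g (r⁻¹ • x) := by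
  have hself := integral_fourier_mul_eq g (dilate r⁻¹ (inv_pos.2 hr).ne' f)
  simp only [dilate_apply, fourier_dilate_apply (inv_pos.2 hr), inv_inv, inv_pow] at hself
  rw [hself, integral_eq_pow_smul_integral_comp_smul (fun x => 𝓕 f x * g (r⁻¹ • x)) hr,
    ← integral_smul]
  simp only [smul_smul, inv_mul_cancel₀ hr.ne', one_smul, mul_smul_comm, mul_comm]

end Fourier

/-! ### The lattice partition of unity -/

theorem abs_apply_le_norm {n : ℕ} (x : Rn n) (i : Fin n) : |x i| ≤ ‖x‖ := by
  simpa using PiLp.norm_apply_le x i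

theorem norm_le_mul_of_forall_abs_le {n : ℕ} {x : Rn n} {c : ℝ} (h : ∀ i, |x i| ≤ c) :
    ‖x‖ ≤ n * c := by
  calc ‖x‖ = ‖∑ i, x i • EuclideanSpace.basisFun (Fin n) ℝ i‖ := by
        exact congrArg norm (by simpa using ((EuclideanSpace.basisFun (Fin n) ℝ).sum_repr x).symm)
    _ ≤ ∑ i, |x i| := (norm_sum_le _ _).trans_eq (by simp [norm_smul])
    _ ≤ n * c := (Finset.sum_le_sum fun i _ => h i).trans_eq (by simp)

@[simp] theorem latticePoint_apply {n : ℕ} (k : Fin n → ℤ) (i : Fin n) :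
    latticePoint k i = k i := rfl

@[simp] theorem latticePoint_zero (n : ℕ) : (latticePoint 0 : Rn n) = 0 := by
  ext i
  simp

theorem finite_lattice_near {n : ℕ} (ξ : Rn n) (c : ℝ) :
    {l : Fin n → ℤ | ∀ i, |ξ i - l i| ≤ c}.Finite := by
  refine (Set.finite_Icc (fun i => ⌊ξ i - c⌋) (fun i => ⌈ξ i + c⌉)).subset fun l hl => ?_
  refine ⟨fun i => ?_, fun i => ?_⟩
  · have := abs_le.1 (hl i)
    have h : (⌊ξ i - c⌋ : ℝ) ≤ l i := (Int.floor_le _).trans (by linarith)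
    exact_mod_cast h
  · have := abs_le.1 (hl i)
    have h : (l i : ℝ) ≤ ⌈ξ i + c⌉ := le_trans (by linarith) (Int.le_ceil _)
    exact_mod_cast h

namespace IsWindow

variable {n : ℕ} {η : Rn n → ℝ} (hη : IsWindow η)
include hη

theorem abs_sub_lt_of_ne_zero {ξ : Rn n} {l : Fin n → ℤ} (h : η (ξ - latticePoint l) ≠ 0)
    (i : Fin n) : |ξ i - l i| < 3 / 4 := by
  by_contra! hc
  exact h (hη.eq_zero _ ⟨i, by simpa using hc⟩)

theorem finite_support_translates (ξ : Rn n) :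
    (Function.support fun l : Fin n → ℤ => η (ξ - latticePoint l)).Finite :=
  (finite_lattice_near ξ 1).subset fun _ hl i =>
    (hη.abs_sub_lt_of_ne_zero hl i).le.trans (by norm_num)

theorem one_le_tsum (ξ : Rn n) : 1 ≤ ∑' l : Fin n → ℤ, η (ξ - latticePoint l) := by
  have h1 : η (ξ - latticePoint fun i => round (ξ i)) = 1 :=
    hη.eq_one _ fun i => by simpa using abs_sub_round (ξ i)
  rw [← h1]
  exact (summable_of_hasFiniteSupport (hη.finite_support_translates ξ)).le_tsum _
    fun l _ => (hη.mem_Icc _).1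

theorem contDiff_tsum : ContDiff ℝ ∞ fun ξ => ∑' l : Fin n → ℤ, η (ξ - latticePoint l) := by
  refine contDiff_iff_contDiffAt.2 fun ξ₀ => ?_
  set S := (finite_lattice_near ξ₀ 2).toFinset
  have heq : (fun ξ => ∑' l : Fin n → ℤ, η (ξ - latticePoint l)) =ᶠ[𝓝 ξ₀]
      fun ξ => ∑ l ∈ S, η (ξ - latticePoint l) := by
    filter_upwards [Metric.ball_mem_nhds ξ₀ one_pos] with ξ hξ
    refine tsum_eq_sum fun l hl => ?_
    by_contra hne
    refine hl ((Set.Finite.mem_toFinset _).2 fun i => ?_)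
    have h1 := hη.abs_sub_lt_of_ne_zero hne i
    have h2 : |ξ i - ξ₀ i| < 1 :=
      (abs_apply_le_norm (ξ - ξ₀) i).trans_lt (mem_ball_iff_norm.1 hξ)
    rw [abs_lt] at h1 h2
    rw [abs_le]
    constructor <;> linarith
  refine ContDiffAt.congr_of_eventuallyEq ?_ heq
  refine ContDiff.contDiffAt (ContDiff.sum fun l _ => ?_)
  exact hη.contDiff.comp (contDiff_id.sub contDiff_const)

theorem contDiff_partitionFun (k : Fin n → ℤ) : ContDiff ℝ ∞ (partitionFun η k) := by
  refine (hη.contDiff.comp (contDiff_id.sub contDiff_const)).mul (hη.contDiff_tsum.inv fun ξ => ?_)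
  have := hη.one_le_tsum ξ
  positivity

theorem abs_sub_lt_of_partitionFun_ne_zero {k : Fin n → ℤ} {ξ : Rn n}
    (h : partitionFun η k ξ ≠ 0) (i : Fin n) : |ξ i - k i| < 3 / 4 :=
  hη.abs_sub_lt_of_ne_zero (left_ne_zero_of_mul h) i

theorem norm_sub_le_of_partitionFun_ne_zero {k : Fin n → ℤ} {ξ : Rn n}
    (h : partitionFun η k ξ ≠ 0) : ‖ξ - latticePoint k‖ ≤ n :=
  (norm_le_mul_of_forall_abs_le (c := 1) fun i => by
    simpa using (hη.abs_sub_lt_of_partitionFun_ne_zero h i).le.trans (by norm_num)).trans_eq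
      (mul_one _)

theorem hasCompactSupport_partitionFun (k : Fin n → ℤ) : HasCompactSupport (partitionFun η k) := by
  refine HasCompactSupport.intro (isCompact_closedBall (latticePoint k) n) fun ξ hξ => ?_
  by_contra h
  exact hξ (mem_closedBall_iff_norm.2 (hη.norm_sub_le_of_partitionFun_ne_zero h))

theorem tsum_partitionFun (ξ : Rn n) : ∑' k, partitionFun η k ξ = 1 := by
  simp only [partitionFun, tsum_mul_right]
  exact mul_inv_cancel₀ (by have := hη.one_le_tsum ξ; positivity)

theorem finite_support_partitionFun (ξ : Rn n) :
    (Function.support fun k => partitionFun η k ξ).Finite :=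
  (hη.finite_support_translates ξ).subset fun _ h => left_ne_zero_of_mul h

theorem partitionFun_nonneg (k : Fin n → ℤ) (ξ : Rn n) : 0 ≤ partitionFun η k ξ :=
  mul_nonneg (hη.mem_Icc _).1 (inv_nonneg.2 (zero_le_one.trans (hη.one_le_tsum ξ)))

theorem partitionFun_le_one (k : Fin n → ℤ) (ξ : Rn n) : partitionFun η k ξ ≤ 1 := by
  rw [← hη.tsum_partitionFun ξ]
  exact (summable_of_hasFiniteSupport (hη.finite_support_partitionFun ξ)).le_tsum k
    fun l _ => hη.partitionFun_nonneg l ξ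

theorem partitionFun_eq_zero_of_ne {k l : Fin n → ℤ} (hkl : l ≠ k) {ξ : Rn n}
    (hξ : ‖ξ - latticePoint k‖ ≤ 1 / 4) : partitionFun η l ξ = 0 := by
  by_contra h
  refine hkl (funext fun i => ?_)
  have h1 := hη.abs_sub_lt_of_partitionFun_ne_zero h i
  have h2 : |ξ i - k i| ≤ 1 / 4 := (abs_apply_le_norm (ξ - latticePoint k) i).trans hξ
  rw [abs_lt] at h1
  rw [abs_le] at h2
  have hlk : l i < k i + 1 := by exact_mod_cast (by linarith : (l i : ℝ) < k i + 1)
  have hkl : k i < l i + 1 := by exact_mod_cast (by linarith : (k i : ℝ) < l i + 1)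
  omega

theorem partitionFun_eq_one {k : Fin n → ℤ} {ξ : Rn n}
    (hξ : ‖ξ - latticePoint k‖ ≤ 1 / 4) : partitionFun η k ξ = 1 := by
  rw [← hη.tsum_partitionFun ξ, tsum_eq_single k]
  exact fun l hl => hη.partitionFun_eq_zero_of_ne hl hξ

/-- `σ_k` as a Schwartz function. -/
def partitionSchwartz (k : Fin n → ℤ) : 𝓢(Rn n, ℂ) :=
  ofRealSchwartz (hη.contDiff_partitionFun k) (hη.hasCompactSupport_partitionFun k)

theorem hasTemperateGrowth_partitionFun (k : Fin n → ℤ) :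
    Function.HasTemperateGrowth fun ξ => (partitionFun η k ξ : ℂ) :=
  (hη.partitionSchwartz k).hasTemperateGrowth

end IsWindow

/-! ### Functions representing a tempered distribution -/

section IsGivenBy

variable {n : ℕ} {u : 𝓢'(Rn n, ℂ)}

theorem IsGivenBy.locallyIntegrable {h : Rn n → ℂ} (hu : IsGivenBy u h) :
    LocallyIntegrable h := by
  intro x
  let b : ContDiffBump x := ⟨1, 2, one_pos, one_lt_two⟩
  refine ⟨Metric.closedBall x 1, Metric.closedBall_mem_nhds x one_pos, ?_⟩
  refine (hu (bumpSchwartz b)).1.integrableOn.congr_fun (fun y hy => ?_) measurableSet_closedBall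
  simp only [bumpSchwartz_eq_one b hy, one_mul]

theorem IsGivenBy.ae_eq {h₁ h₂ : Rn n → ℂ} (hu₁ : IsGivenBy u h₁) (hu₂ : IsGivenBy u h₂) :
    h₁ =ᵐ[volume] h₂ := by
  refine ae_eq_of_integral_contDiff_smul_eq hu₁.locallyIntegrable hu₂.locallyIntegrable
    fun φ hφ hc => ?_
  simp only [Complex.real_smul]
  exact (hu₁ (ofRealSchwartz hφ hc)).2.symm.trans (hu₂ (ofRealSchwartz hφ hc)).2

theorem IsGivenBy.distLpNorm_eq {h : Rn n → ℂ} (hu : IsGivenBy u h) (p : ℝ≥0∞) :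
    distLpNorm p u = eLpNorm h p volume := by
  refine le_antisymm (iInf₂_le h hu) (le_iInf₂ fun h' hu' => ?_)
  rw [eLpNorm_congr_ae (hu.ae_eq hu')]

theorem isGivenBy_toTemperedDistribution (f : 𝓢(Rn n, ℂ)) :
    IsGivenBy (toTemperedDistributionCLM (Rn n) ℂ volume f) f := fun g =>
  ⟨f.integrable.bdd_mul (c := SchwartzMap.seminorm ℂ 0 0 g) g.continuous.aestronglyMeasurable
    (Eventually.of_forall fun x => norm_le_seminorm ℂ g x),
    toTemperedDistributionCLM_apply_apply volume f g⟩

theorem isGivenBy_zero : IsGivenBy (0 : 𝓢'(Rn n, ℂ)) 0 := fun g => by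
  refine ⟨by simp, ?_⟩
  simp only [Pi.zero_apply, mul_zero, integral_zero]
  rfl

@[simp] theorem distLpNorm_zero (p : ℝ≥0∞) : distLpNorm p (0 : 𝓢'(Rn n, ℂ)) = 0 := by
  rw [isGivenBy_zero.distLpNorm_eq, eLpNorm_zero]

theorem enorm_apply_le_distLpNorm_mul_eLpNorm {p p' : ℝ≥0∞} [p.HolderConjugate p']
    (u : 𝓢'(Rn n, ℂ)) (g : 𝓢(Rn n, ℂ)) : ‖u g‖ₑ ≤ distLpNorm p u * eLpNorm g p' volume := by
  by_cases hg : g = 0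
  · simp [hg]
  have hne_zero : eLpNorm g p' volume ≠ 0 := by
    rw [Ne, eLpNorm_eq_zero_iff g.continuous.aestronglyMeasurable
      (ENNReal.HolderConjugate.pos p' p).ne',
      Continuous.ae_eq_iff_eq volume g.continuous continuous_zero]
    exact fun h => hg (DFunLike.coe_injective h)
  have hne_top := (g.memLp p' volume).eLpNorm_ne_top
  rw [← ENNReal.div_le_iff hne_zero hne_top]
  refine le_iInf₂ fun h hu => ?_
  rw [ENNReal.div_le_iff hne_zero hne_top, (hu g).2]
  calc ‖∫ x, g x * h x‖ₑ ≤ ∫⁻ x, ‖g x * h x‖ₑ := enorm_integral_le_lintegral_enorm _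
    _ = eLpNorm (h • (g : Rn n → ℂ)) 1 volume := by
        rw [eLpNorm_one_eq_lintegral_enorm]
        simp only [Pi.smul_apply', smul_eq_mul, mul_comm]
    _ ≤ eLpNorm h p volume * eLpNorm g p' volume :=
        eLpNorm_smul_le_mul_eLpNorm g.continuous.aestronglyMeasurable
          hu.locallyIntegrable.aestronglyMeasurable

end IsGivenBy

/-! ### The sequence norm and the modulation norm -/

section lqNorm

variable {ι : Type*} {q : ℝ≥0∞}

theorem le_lqNorm (hq : 0 < q) (a : ι → ℝ≥0∞) (i : ι) : a i ≤ lqNorm q a := by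
  rw [lqNorm]
  split_ifs with h
  · exact le_iSup a i
  · have hq' : 0 < q.toReal := ENNReal.toReal_pos hq.ne' h
    calc a i = (a i ^ q.toReal) ^ (1 / q.toReal) := by
          rw [← ENNReal.rpow_mul, mul_one_div_cancel hq'.ne', ENNReal.rpow_one]
      _ ≤ _ := ENNReal.rpow_le_rpow (ENNReal.le_tsum i) (by positivity)

theorem lqNorm_eq_of_forall_ne (hq : 0 < q) {a : ι → ℝ≥0∞} (i : ι) (ha : ∀ j, j ≠ i → a j = 0) :
    lqNorm q a = a i := by
  refine le_antisymm ?_ (le_lqNorm hq a i)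
  rw [lqNorm]
  split_ifs with h
  · refine iSup_le fun j => ?_
    by_cases hj : j = i
    · rw [hj]
    · simp [ha j hj]
  · have hq' : 0 < q.toReal := ENNReal.toReal_pos hq.ne' h
    rw [tsum_eq_single i fun j hj => by rw [ha j hj, ENNReal.zero_rpow_of_pos hq'],
      ← ENNReal.rpow_mul, mul_one_div_cancel hq'.ne', ENNReal.rpow_one]

theorem lqNorm_zero (hq : 0 < q) : lqNorm q (fun _ : ι => (0 : ℝ≥0∞)) = 0 := by
  rw [lqNorm]
  split_ifs with h
  · simp
  · have hq' : 0 < q.toReal := ENNReal.toReal_pos hq.ne' h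
    simp [ENNReal.zero_rpow_of_pos hq', hq']

theorem sum_rpow_le_lqNorm_rpow (hq : 0 < q) (h : q ≠ ⊤) (a : ι → ℝ≥0∞) (s : Finset ι) :
    ∑ i ∈ s, a i ^ q.toReal ≤ lqNorm q a ^ q.toReal := by
  have hq' : 0 < q.toReal := ENNReal.toReal_pos hq.ne' h
  rw [lqNorm, if_neg h, ← ENNReal.rpow_mul, one_div_mul_cancel hq'.ne', ENNReal.rpow_one]
  exact ENNReal.sum_le_tsum s

end lqNorm

theorem modulationNorm_zero {n : ℕ} (η : Rn n → ℝ) (p : ℝ≥0∞) {q : ℝ≥0∞} (hq : 0 < q) :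
    modulationNorm η p q 0 = 0 := by
  simp only [modulationNorm, map_zero, distLpNorm_zero]
  exact lqNorm_zero hq

theorem boxOp_apply_fourier {n : ℕ} (η : Rn n → ℝ) (k : Fin n → ℤ) (u : 𝓢'(Rn n, ℂ))
    (W : 𝓢(Rn n, ℂ)) :
    boxOp η k u (𝓕 W) = u (𝓕 (smulLeftCLM ℂ (fun ξ => (partitionFun η k ξ : ℂ)) W)) := by
  rw [boxOp, TemperedDistribution.fourierMultiplierCLM_apply_apply,
    FourierTransform.fourierInv_fourier_eq]

theorem IsWindow.boxOp_toTemperedDistribution {n : ℕ} {η : Rn n → ℝ} (hη : IsWindow η)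
    (k : Fin n → ℤ) (f : 𝓢(Rn n, ℂ)) :
    boxOp η k (toTemperedDistributionCLM (Rn n) ℂ volume f) =
      toTemperedDistributionCLM (Rn n) ℂ volume
        (𝓕⁻ (smulLeftCLM ℂ (fun ξ => (partitionFun η k ξ : ℂ)) (𝓕 f))) :=
  TemperedDistribution.fourierMultiplierCLM_toTemperedDistributionCLM_eq
    (hη.hasTemperateGrowth_partitionFun k) f

theorem IsWindow.smulLeft_partitionFun_eq_self {n : ℕ} {η : Rn n → ℝ} (hη : IsWindow η)
    {k : Fin n → ℤ} {V : 𝓢(Rn n, ℂ)} (hV : ∀ ξ, V ξ ≠ 0 → ‖ξ - latticePoint k‖ ≤ 1 / 4) :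
    smulLeftCLM ℂ (fun ξ => (partitionFun η k ξ : ℂ)) V = V := by
  ext ξ
  rw [smulLeftCLM_apply_apply (hη.hasTemperateGrowth_partitionFun k)]
  by_cases h : V ξ = 0
  · simp [h]
  · simp [hη.partitionFun_eq_one (hV ξ h)]

/-- Only the box at `k` sees `f`, and it sees all of `f`. -/
theorem IsWindow.modulationNorm_eq_of_fourier_support {n : ℕ} {η : Rn n → ℝ} (hη : IsWindow η)
    (p : ℝ≥0∞) {q : ℝ≥0∞} (hq : 0 < q) {k : Fin n → ℤ} {f : 𝓢(Rn n, ℂ)}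
    (hf : ∀ ξ, 𝓕 f ξ ≠ 0 → ‖ξ - latticePoint k‖ ≤ 1 / 4) :
    modulationNorm η p q (toTemperedDistributionCLM (Rn n) ℂ volume f) = eLpNorm f p volume := by
  have hother : ∀ l, l ≠ k → smulLeftCLM ℂ (fun ξ => (partitionFun η l ξ : ℂ)) (𝓕 f) = 0 := by
    intro l hlk
    ext ξ
    rw [smulLeftCLM_apply_apply (hη.hasTemperateGrowth_partitionFun l)]
    by_cases h : 𝓕 f ξ = 0
    · simp [h]
    · simp [hη.partitionFun_eq_zero_of_ne hlk (hf ξ h)]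
  rw [modulationNorm, lqNorm_eq_of_forall_ne hq k]
  · rw [hη.boxOp_toTemperedDistribution, hη.smulLeft_partitionFun_eq_self hf,
      FourierTransform.fourierInv_fourier_eq,
      (isGivenBy_toTemperedDistribution f).distLpNorm_eq]
  · intro l hlk
    rw [hη.boxOp_toTemperedDistribution, hother l hlk, FourierTransform.fourierInv_zero, map_zero,
      distLpNorm_zero]

theorem distLpNorm_boxOp_le_modulationNorm {n : ℕ} (η : Rn n → ℝ) (p : ℝ≥0∞) {q : ℝ≥0∞}
    (hq : 0 < q) (k : Fin n → ℤ) (u : 𝓢'(Rn n, ℂ)) :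
    distLpNorm p (boxOp η k u) ≤ modulationNorm η p q u :=
  le_lqNorm hq (fun k => distLpNorm p (boxOp η k u)) k

/-! ### The bilinear form of the Hausdorff operator -/

namespace IsHausdorffKernel

theorem ae_ne_zero {n : ℕ} [NeZero n] : ∀ᵐ y : Rn n, y ≠ 0 :=
  Measure.ae_ne volume 0

variable {n : ℕ} [NeZero n] {Φ : Rn n → ℂ} (hΦ : IsHausdorffKernel Φ)
include hΦ

theorem integrable_prod (f g : 𝓢(Rn n, ℂ)) :
    Integrable (fun z : Rn n × Rn n => g z.1 * (Φ z.2 * f (‖z.2‖⁻¹ • z.1)))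
      (volume.prod volume) := by
  obtain ⟨A, -, hA⟩ := hΦ.exists_bound
  exact (hA f g).1

theorem hausdorffOp_apply_prod (f g : 𝓢(Rn n, ℂ)) :
    hausdorffOp hΦ f g =
      ∫ z : Rn n × Rn n, g z.1 * (Φ z.2 * f (‖z.2‖⁻¹ • z.1)) ∂(volume.prod volume) :=
  hΦ.integral_mul_hausdorffFun f g

theorem hausdorffOp_apply (f g : 𝓢(Rn n, ℂ)) :
    hausdorffOp hΦ f g = ∫ y, Φ y * ∫ x, g x * f (‖y‖⁻¹ • x) := by
  rw [hΦ.hausdorffOp_apply_prod, integral_prod_symm _ (hΦ.integrable_prod f g)]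
  simp only [← integral_const_mul, mul_left_comm (Φ _)]

theorem hausdorffOp_apply_fourier (f W : 𝓢(Rn n, ℂ)) :
    hausdorffOp hΦ f (𝓕 W) = hausdorffOp hΦ W (𝓕 f) := by
  rw [hΦ.hausdorffOp_apply, hΦ.hausdorffOp_apply]
  refine integral_congr_ae ?_
  filter_upwards [ae_ne_zero] with y hy
  rw [integral_fourier_mul_comp_inv_smul f W (norm_pos_iff.2 hy)]

theorem hausdorffOp_eq_zero_of_compactSupport
    (h : ∀ W : 𝓢(Rn n, ℂ), HasCompactSupport W → hausdorffOp hΦ W = 0) : hausdorffOp hΦ = 0 := by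
  ext f g
  obtain ⟨u, hu_support, hu_le, hu_eq⟩ := exists_seq_hasCompactSupport f
  have hlim : Tendsto (fun j => hausdorffOp hΦ (u j) g) atTop (𝓝 (hausdorffOp hΦ f g)) := by
    simp only [hΦ.hausdorffOp_apply_prod]
    refine tendsto_integral_of_dominated_convergence _
      (fun j => (hΦ.integrable_prod (u j) g).aestronglyMeasurable)
      (hΦ.integrable_prod f g).norm (fun j => Eventually.of_forall fun z => ?_)
      (Eventually.of_forall fun z => ?_)
    · simp only [norm_mul]
      gcongr
      exact hu_le j _
    · refine tendsto_const_nhds.congr' ?_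
      filter_upwards [hu_eq (‖z.2‖⁻¹ • z.1)] with j hj
      rw [hj]
  refine tendsto_nhds_unique hlim (tendsto_const_nhds.congr fun j => ?_)
  rw [h _ (hu_support j)]
  rfl

end IsHausdorffKernel

/-! ### Localisation estimates -/

/-- The integrable weight `min(1, |y|ⁿ) |Φ(y)|`. -/
def kernelWeight {n : ℕ} (Φ : Rn n → ℂ) (y : Rn n) : ℝ := min 1 (‖y‖ ^ n) * ‖Φ y‖

/-- The mass that `Φ` gives to the dilations moving `a` close to `b`, on the scale `1 + |y|` of
a bump of unit width dilated by `|y|`. -/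
def concentration {n : ℕ} (Φ : Rn n → ℂ) (a b : Rn n) : ℝ :=
  ∫ y, kernelWeight Φ y * (1 + ‖b - ‖y‖ • a‖ / (1 + ‖y‖))⁻¹

section Concentration

variable {n : ℕ} {Φ : Rn n → ℂ}

theorem kernelWeight_nonneg (Φ : Rn n → ℂ) (y : Rn n) : 0 ≤ kernelWeight Φ y :=
  mul_nonneg (le_min zero_le_one (by positivity)) (norm_nonneg _)

theorem inv_one_add_norm_div_mem_Icc (a b y : Rn n) :
    (1 + ‖b - ‖y‖ • a‖ / (1 + ‖y‖))⁻¹ ∈ Set.Icc (0 : ℝ) 1 :=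
  ⟨by positivity, inv_le_one_of_one_le₀ (le_add_of_nonneg_right (by positivity))⟩

theorem concentration_nonneg (Φ : Rn n → ℂ) (a b : Rn n) : 0 ≤ concentration Φ a b :=
  integral_nonneg fun y =>
    mul_nonneg (kernelWeight_nonneg Φ y) (inv_one_add_norm_div_mem_Icc a b y).1

namespace IsHausdorffKernel

theorem integrable_kernelWeight (hΦ : IsHausdorffKernel Φ) : Integrable (kernelWeight Φ) := by
  have hmeas : AEStronglyMeasurable (kernelWeight Φ) volume :=
    (Continuous.aestronglyMeasurable (by fun_prop)).mul hΦ.aestronglyMeasurable.norm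
  rw [← integrableOn_univ, ← Set.union_compl_self (Metric.ball (0 : Rn n) 1)]
  refine IntegrableOn.union ?_ ?_
  · refine hΦ.integrableOn_ball.norm.mono' hmeas.restrict (Eventually.of_forall fun y => ?_)
    rw [Real.norm_of_nonneg (kernelWeight_nonneg Φ y), norm_mul, Complex.norm_real,
      Real.norm_of_nonneg (by positivity), kernelWeight]
    gcongr
    exact min_le_right _ _
  · refine hΦ.integrableOn_compl.norm.mono' hmeas.restrict (Eventually.of_forall fun y => ?_)
    rw [Real.norm_of_nonneg (kernelWeight_nonneg Φ y), kernelWeight]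
    exact mul_le_of_le_one_left (norm_nonneg _) (min_le_left _ _)

theorem integrable_concentration (hΦ : IsHausdorffKernel Φ) (a b : Rn n) :
    Integrable fun y => kernelWeight Φ y * (1 + ‖b - ‖y‖ • a‖ / (1 + ‖y‖))⁻¹ := by
  refine hΦ.integrable_kernelWeight.mul_bdd (c := 1) ?_ (Eventually.of_forall fun y => ?_)
  · refine Measurable.aestronglyMeasurable ?_
    fun_prop
  · rw [Real.norm_of_nonneg (inv_one_add_norm_div_mem_Icc a b y).1]
    exact (inv_one_add_norm_div_mem_Icc a b y).2

theorem concentration_le (hΦ : IsHausdorffKernel Φ) (a b : Rn n) :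
    concentration Φ a b ≤ ∫ y, kernelWeight Φ y :=
  integral_mono (hΦ.integrable_concentration a b) hΦ.integrable_kernelWeight fun y =>
    mul_le_of_le_one_right (kernelWeight_nonneg Φ y) (inv_one_add_norm_div_mem_Icc a b y).2

end IsHausdorffKernel

theorem ae_one_sub_sub_norm_mul_ne_zero [NeZero n] (t : ℝ) :
    ∀ᵐ y : Rn n, 1 - t - ‖y‖ * t ≠ 0 := by
  refine measure_mono_null (fun y hy => ?_) (Measure.addHaar_sphere volume 0 ((1 - t) / t))
  have hy : 1 - t - ‖y‖ * t = 0 := not_not.1 hy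
  have ht : t ≠ 0 := by
    rintro rfl
    simp at hy
  rw [mem_sphere_zero_iff_norm, eq_div_iff ht]
  linarith

theorem tendsto_norm_sub_smul_atTop {E : Type*} [NormedAddCommGroup E] [NormedSpace ℝ E]
    {a b : ℕ → E} {t r : ℝ} (hr : 0 ≤ r)
    (hab : Tendsto (fun j => ‖a j‖ + ‖b j‖) atTop atTop)
    (ht : Tendsto (fun j => ‖a j‖ / (‖a j‖ + ‖b j‖)) atTop (𝓝 t)) (hrt : 1 - t - r * t ≠ 0) :
    Tendsto (fun j => ‖b j - r • a j‖) atTop atTop := by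
  refine tendsto_atTop_mono' _ ?_ (hab.atTop_mul_pos (abs_pos.2 hrt)
    ((tendsto_const_nhds.sub ht).sub (ht.const_mul r)).abs)
  filter_upwards [hab.eventually_gt_atTop 0] with j hj
  calc (‖a j‖ + ‖b j‖) * |1 - ‖a j‖ / (‖a j‖ + ‖b j‖) - r * (‖a j‖ / (‖a j‖ + ‖b j‖))|
      = |‖b j‖ - ‖r • a j‖| := by
        rw [← abs_of_pos hj, ← abs_mul, abs_of_pos hj, norm_smul, Real.norm_of_nonneg hr]
        congr 1
        field_simp
        ring
    _ ≤ ‖b j - r • a j‖ := abs_norm_sub_norm_le _ _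

theorem IsHausdorffKernel.tendsto_concentration_zero [NeZero n] (hΦ : IsHausdorffKernel Φ)
    {a b : ℕ → Rn n} {t : ℝ} (hab : Tendsto (fun j => ‖a j‖ + ‖b j‖) atTop atTop)
    (ht : Tendsto (fun j => ‖a j‖ / (‖a j‖ + ‖b j‖)) atTop (𝓝 t)) :
    Tendsto (fun j => concentration Φ (a j) (b j)) atTop (𝓝 0) := by
  rw [← integral_zero (Rn n) ℝ]
  refine tendsto_integral_of_dominated_convergence (kernelWeight Φ)
    (fun j => (hΦ.integrable_concentration _ _).aestronglyMeasurable)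
    hΦ.integrable_kernelWeight (fun j => Eventually.of_forall fun y => ?_) ?_
  · have hmem := inv_one_add_norm_div_mem_Icc (a j) (b j) y
    rw [Real.norm_of_nonneg (mul_nonneg (kernelWeight_nonneg Φ y) hmem.1)]
    exact mul_le_of_le_one_right (kernelWeight_nonneg Φ y) hmem.2
  · filter_upwards [ae_one_sub_sub_norm_mul_ne_zero t] with y hy
    rw [← mul_zero (kernelWeight Φ y)]
    exact Tendsto.const_mul _ (tendsto_inv_atTop_zero.comp (tendsto_atTop_add_const_left _ _
      ((tendsto_norm_sub_smul_atTop (norm_nonneg y) hab ht hy).atTop_div_const (by positivity))))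

/-- Spheres are null sets, so `Φ` cannot concentrate on a single dilation. -/
theorem IsHausdorffKernel.exists_concentration_le [NeZero n] (hΦ : IsHausdorffKernel Φ) {ε : ℝ}
    (hε : 0 < ε) : ∃ L : ℝ, ∀ a b : Rn n, L ≤ ‖a‖ + ‖b‖ → concentration Φ a b ≤ ε := by
  by_contra! hcon
  choose a b hL hc using fun j : ℕ => hcon j
  have hab : Tendsto (fun j => ‖a j‖ + ‖b j‖) atTop atTop :=
    tendsto_atTop_mono hL tendsto_natCast_atTop_atTop
  have ht : ∀ j, ‖a j‖ / (‖a j‖ + ‖b j‖) ∈ Set.Icc (0 : ℝ) 1 := fun j =>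
    ⟨by positivity, div_le_one_of_le₀ (by linarith [norm_nonneg (b j)]) (by positivity)⟩
  obtain ⟨t, -, φ, hφ, htφ⟩ := isCompact_Icc.tendsto_subseq ht
  have hlim := hΦ.tendsto_concentration_zero (hab.comp hφ.tendsto_atTop) htφ
  exact hε.not_ge (ge_of_tendsto' hlim fun j => (hc (φ j)).le)

end Concentration

section Japanese

variable {E : Type*} [NormedAddCommGroup E]

theorem one_add_norm_sub_smul_div_le [NormedSpace ℝ E] (a b t : E) {r : ℝ} (hr : 0 < r) :
    1 + ‖b - r • a‖ / (1 + r) ≤ (1 + ‖r⁻¹ • t - a‖) * (1 + ‖t - b‖) := by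
  have hsplit : b - r • a = r • (r⁻¹ • t - a) - (t - b) := by
    rw [smul_sub, smul_inv_smul₀ hr.ne']
    abel
  have hnorm : ‖b - r • a‖ ≤ r * ‖r⁻¹ • t - a‖ + ‖t - b‖ := by
    rw [hsplit]
    refine (norm_sub_le _ _).trans_eq ?_
    rw [norm_smul, Real.norm_of_nonneg hr.le]
  have hdiv : ‖b - r • a‖ / (1 + r) ≤ ‖r⁻¹ • t - a‖ + ‖t - b‖ := by
    rw [div_le_iff₀ (by positivity)]
    nlinarith [norm_nonneg (t - b), norm_nonneg (r⁻¹ • t - a)]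
  nlinarith [mul_nonneg (norm_nonneg (t - b)) (norm_nonneg (r⁻¹ • t - a))]

theorem norm_mul_norm_comp_inv_smul_le [NormedSpace ℝ E] {F G : Type*} [NormedAddCommGroup F]
    [NormedAddCommGroup G] {A : E → F} {B : E → G} {a b : E} {m k : ℕ} {C₁ C₂ : ℝ}
    (hA : ∀ t, (1 + ‖t - a‖) ^ (m + k) * ‖A t‖ ≤ C₁)
    (hB : ∀ t, (1 + ‖t - b‖) ^ (m + k) * ‖B t‖ ≤ C₂) {r : ℝ} (hr : 0 < r) (t : E) :
    ‖B t‖ * ‖A (r⁻¹ • t)‖ ≤ C₁ * C₂ * ((1 + ‖b - r • a‖ / (1 + r)) ^ k)⁻¹ *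
      (((1 + ‖r⁻¹ • t - a‖) ^ m)⁻¹ * ((1 + ‖t - b‖) ^ m)⁻¹) := by
  set u := 1 + ‖r⁻¹ • t - a‖
  set v := 1 + ‖t - b‖
  rw [← mul_inv, mul_assoc, ← mul_inv, ← div_eq_mul_inv, le_div_iff₀ (by positivity)]
  calc ‖B t‖ * ‖A (r⁻¹ • t)‖ * ((1 + ‖b - r • a‖ / (1 + r)) ^ k * (u ^ m * v ^ m))
      ≤ ‖B t‖ * ‖A (r⁻¹ • t)‖ * ((u * v) ^ k * (u ^ m * v ^ m)) := by
        gcongr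
        exact one_add_norm_sub_smul_div_le a b t hr
    _ = u ^ (m + k) * ‖A (r⁻¹ • t)‖ * (v ^ (m + k) * ‖B t‖) := by
        rw [pow_add, pow_add, mul_pow]
        ring
    _ ≤ C₁ * C₂ := mul_le_mul (hA _) (hB t) (by positivity) (le_trans (by positivity) (hA a))

variable [InnerProductSpace ℝ E] [FiniteDimensional ℝ E] [MeasurableSpace E] [BorelSpace E]

theorem integral_comp_inv_smul_mul_le_min {u v : E → ℝ} (hu : ∀ x, u x ∈ Set.Icc (0 : ℝ) 1)
    (hv : ∀ x, v x ∈ Set.Icc (0 : ℝ) 1) (hu_int : Integrable u) (hv_int : Integrable v) {r : ℝ}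
    (hr : 0 < r) :
    ∫ x, u (r⁻¹ • x) * v x ≤ min (∫ x, v x) (r ^ Module.finrank ℝ E * ∫ x, u x) := by
  have hnonneg : 0 ≤ᵐ[volume] fun x => u (r⁻¹ • x) * v x :=
    Eventually.of_forall fun x => mul_nonneg (hu _).1 (hv x).1
  refine le_min ?_ ?_
  · exact integral_mono_of_nonneg hnonneg hv_int
      (Eventually.of_forall fun x => mul_le_of_le_one_left (hv x).1 (hu _).2)
  · rw [← smul_eq_mul, ← Measure.integral_comp_inv_smul_of_nonneg volume u hr.le]
    exact integral_mono_of_nonneg hnonneg (hu_int.comp_smul (inv_ne_zero hr.ne'))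
      (Eventually.of_forall fun x => mul_le_of_le_one_right (hu _).1 (hv x).2)

variable (E) in
/-- The integral `∫ (1 + |x|)^{-(d+1)} dx` over a `d`-dimensional space. -/
def japaneseIntegral : ℝ := ∫ x : E, ((1 + ‖x‖) ^ (Module.finrank ℝ E + 1))⁻¹

variable (E) in
theorem japaneseIntegral_nonneg : 0 ≤ japaneseIntegral E :=
  integral_nonneg fun _ => by positivity

theorem integrable_japanese_sub (a : E) :
    Integrable fun x => ((1 + ‖x - a‖) ^ (Module.finrank ℝ E + 1))⁻¹ := by
  have h := integrable_one_add_norm (E := E) (μ := volume) (r := Module.finrank ℝ E + 1) (by simp)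
  refine (h.comp_sub_right a).congr (Eventually.of_forall fun x => ?_)
  simp only
  rw [Real.rpow_neg (by positivity)]
  norm_cast

theorem integral_japanese_sub (a : E) :
    ∫ x, ((1 + ‖x - a‖) ^ (Module.finrank ℝ E + 1))⁻¹ = japaneseIntegral E :=
  integral_sub_right_eq_self (fun x : E => ((1 + ‖x‖) ^ (Module.finrank ℝ E + 1))⁻¹) a

theorem integral_norm_mul_norm_comp_inv_smul_le {F G : Type*} [NormedAddCommGroup F]
    [NormedAddCommGroup G] {A : E → F} {B : E → G} {a b : E} {k : ℕ} {C₁ C₂ : ℝ}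
    (hA : ∀ t, (1 + ‖t - a‖) ^ (Module.finrank ℝ E + 1 + k) * ‖A t‖ ≤ C₁)
    (hB : ∀ t, (1 + ‖t - b‖) ^ (Module.finrank ℝ E + 1 + k) * ‖B t‖ ≤ C₂) {r : ℝ} (hr : 0 < r) :
    ∫ t, ‖B t‖ * ‖A (r⁻¹ • t)‖ ≤ C₁ * C₂ * japaneseIntegral E *
      (min 1 (r ^ Module.finrank ℝ E) * ((1 + ‖b - r • a‖ / (1 + r)) ^ k)⁻¹) := by
  have hC : 0 ≤ C₁ * C₂ :=
    mul_nonneg (le_trans (by positivity) (hA a)) (le_trans (by positivity) (hB a))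
  have hmem : ∀ a x : E, ((1 + ‖x - a‖) ^ (Module.finrank ℝ E + 1))⁻¹ ∈ Set.Icc (0 : ℝ) 1 :=
    fun a x => ⟨by positivity,
      inv_le_one_of_one_le₀ (one_le_pow₀ (le_add_of_nonneg_right (norm_nonneg _)))⟩
  have hmin := integral_comp_inv_smul_mul_le_min (hmem a) (hmem b) (integrable_japanese_sub a)
    (integrable_japanese_sub b) hr
  rw [integral_japanese_sub, integral_japanese_sub] at hmin
  have hbdd := (integrable_japanese_sub b).bdd_mul (c := 1)
    ((integrable_japanese_sub a).comp_smul (inv_ne_zero hr.ne')).aestronglyMeasurable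
    (Eventually.of_forall fun x => by
      rw [Real.norm_of_nonneg (hmem a _).1]
      exact (hmem a _).2)
  calc ∫ t, ‖B t‖ * ‖A (r⁻¹ • t)‖
      ≤ C₁ * C₂ * ((1 + ‖b - r • a‖ / (1 + r)) ^ k)⁻¹ *
          min (japaneseIntegral E) (r ^ Module.finrank ℝ E * japaneseIntegral E) := by
        refine (integral_mono_of_nonneg (Eventually.of_forall fun t => by positivity)
          (hbdd.const_mul _) (Eventually.of_forall
            (norm_mul_norm_comp_inv_smul_le hA hB hr))).trans ?_
        rw [integral_const_mul]
        gcongr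
    _ = _ := by
        nth_rw 1 [← one_mul (japaneseIntegral E)]
        rw [← min_mul_of_nonneg _ _ (japaneseIntegral_nonneg E)]
        ring

end Japanese

namespace IsHausdorffKernel

variable {n : ℕ} [NeZero n] {Φ : Rn n → ℂ} {f g : 𝓢(Rn n, ℂ)} {a b : Rn n} {C₁ C₂ : ℝ}

theorem integral_norm_le_concentration (hΦ : IsHausdorffKernel Φ)
    (hf : ∀ t, (1 + ‖t - a‖) ^ (n + 2) * ‖f t‖ ≤ C₁)
    (hg : ∀ t, (1 + ‖t - b‖) ^ (n + 2) * ‖g t‖ ≤ C₂) :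
    ∫ z : Rn n × Rn n, ‖g z.1 * (Φ z.2 * f (‖z.2‖⁻¹ • z.1))‖ ∂(volume.prod volume) ≤
      C₁ * C₂ * japaneseIntegral (Rn n) * concentration Φ a b := by
  have hInt := (hΦ.integrable_prod f g).norm
  rw [integral_prod_symm _ hInt, concentration, ← integral_const_mul]
  refine integral_mono_ae hInt.integral_prod_right
    ((hΦ.integrable_concentration a b).const_mul _) ?_
  filter_upwards [ae_ne_zero] with y hy
  have hslice := integral_norm_mul_norm_comp_inv_smul_le (A := f) (B := g) (a := a) (b := b)
    (k := 1) (by simpa using hf) (by simpa using hg) (norm_pos_iff.2 hy)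
  rw [finrank_euclideanSpace_fin, pow_one] at hslice
  calc ∫ x, ‖g x * (Φ y * f (‖y‖⁻¹ • x))‖ = ‖Φ y‖ * ∫ x, ‖g x‖ * ‖f (‖y‖⁻¹ • x)‖ := by
        simp only [norm_mul, mul_left_comm, integral_const_mul]
    _ ≤ ‖Φ y‖ * _ := mul_le_mul_of_nonneg_left hslice (norm_nonneg _)
    _ = _ := by
        rw [kernelWeight]
        ring

theorem norm_hausdorffOp_apply_le (hΦ : IsHausdorffKernel Φ)
    (hf : ∀ t, (1 + ‖t - a‖) ^ (n + 2) * ‖f t‖ ≤ C₁)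
    (hg : ∀ t, (1 + ‖t - b‖) ^ (n + 2) * ‖g t‖ ≤ C₂) :
    ‖hausdorffOp hΦ f g‖ ≤ C₁ * C₂ * japaneseIntegral (Rn n) * concentration Φ a b := by
  rw [hΦ.hausdorffOp_apply_prod]
  exact (norm_integral_le_integral_norm _).trans (hΦ.integral_norm_le_concentration hf hg)

end IsHausdorffKernel

/-! ### The function giving `□_k H_Φ f` -/

namespace IsHausdorffKernel

variable {n : ℕ} {Φ : Rn n → ℂ}

theorem aestronglyMeasurable_hausdorffFun (hΦ : IsHausdorffKernel Φ) (f : 𝓢(Rn n, ℂ)) :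
    AEStronglyMeasurable (hausdorffFun Φ f) volume := by
  have hdil : Measurable fun z : Rn n × Rn n => f (‖z.2‖⁻¹ • z.1) :=
    f.continuous.measurable.comp (by fun_prop)
  exact (hΦ.aestronglyMeasurable.comp_snd.mul hdil.aestronglyMeasurable).integral_prod_right'

variable [NeZero n] (hΦ : IsHausdorffKernel Φ)
include hΦ

theorem integrable_mul_hausdorffFun (f g : 𝓢(Rn n, ℂ)) :
    Integrable fun x => g x * hausdorffFun Φ f x := by
  refine (hΦ.integrable_prod f g).integral_prod_left.congr (Eventually.of_forall fun x => ?_)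
  simp only [integral_const_mul, hausdorffFun]

theorem integral_norm_mul_hausdorffFun_le (f g : 𝓢(Rn n, ℂ)) :
    ∫ x, ‖g x * hausdorffFun Φ f x‖ ≤
      ∫ z : Rn n × Rn n, ‖g z.1 * (Φ z.2 * f (‖z.2‖⁻¹ • z.1))‖ ∂(volume.prod volume) := by
  have hInt := (hΦ.integrable_prod f g).norm
  rw [integral_prod _ hInt]
  refine integral_mono (hΦ.integrable_mul_hausdorffFun f g).norm hInt.integral_prod_left
    fun x => ?_
  simp only
  rw [hausdorffFun, ← integral_const_mul]
  exact norm_integral_le_integral_norm _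

theorem exists_integral_norm_translate_mul_hausdorffFun_le (f K : 𝓢(Rn n, ℂ)) :
    ∃ C : ℝ, ∀ a, ∫ t, ‖compSubConstCLM ℂ a K t * hausdorffFun Φ f t‖ ≤ C := by
  obtain ⟨C₁, hC₁, hf⟩ := exists_decay f (n + 2)
  obtain ⟨C₂, hC₂, hK⟩ := exists_decay_compSubConst K (n + 2)
  refine ⟨C₁ * C₂ * japaneseIntegral (Rn n) * ∫ y, kernelWeight Φ y, fun a => ?_⟩
  have hJ := japaneseIntegral_nonneg (Rn n)
  calc ∫ t, ‖compSubConstCLM ℂ a K t * hausdorffFun Φ f t‖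
      ≤ C₁ * C₂ * japaneseIntegral (Rn n) * concentration Φ 0 a :=
        (hΦ.integral_norm_mul_hausdorffFun_le f _).trans
          (hΦ.integral_norm_le_concentration (by simpa using hf) (hK a))
    _ ≤ _ := by
        gcongr
        exact hΦ.concentration_le 0 a

theorem integrable_prod_mul_translate_mul_hausdorffFun (f G K : 𝓢(Rn n, ℂ)) :
    Integrable (fun z : Rn n × Rn n =>
      G z.1 * (compSubConstCLM ℂ z.1 K z.2 * hausdorffFun Φ f z.2)) (volume.prod volume) := by
  obtain ⟨C, hC⟩ := hΦ.exists_integral_norm_translate_mul_hausdorffFun_le f K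
  have hmeas : AEStronglyMeasurable (fun z : Rn n × Rn n =>
      G z.1 * (compSubConstCLM ℂ z.1 K z.2 * hausdorffFun Φ f z.2)) (volume.prod volume) := by
    simp only [compSubConstCLM_apply]
    exact (G.continuous.comp continuous_fst).aestronglyMeasurable.mul
      ((K.continuous.comp (continuous_snd.sub continuous_fst)).aestronglyMeasurable.mul
        (hΦ.aestronglyMeasurable_hausdorffFun f).comp_snd)
  rw [integrable_prod_iff hmeas]
  refine ⟨Eventually.of_forall fun x =>
    (hΦ.integrable_mul_hausdorffFun f (compSubConstCLM ℂ x K)).const_mul (G x), ?_⟩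
  refine (G.integrable.norm.mul_const C).mono' hmeas.norm.integral_prod_right'
    (Eventually.of_forall fun x => ?_)
  simp only [norm_mul (G x), integral_const_mul]
  rw [norm_mul, norm_norm, Real.norm_of_nonneg (integral_nonneg fun _ => norm_nonneg _)]
  exact mul_le_mul_of_nonneg_left (hC x) (norm_nonneg _)

theorem isGivenBy_boxOp_hausdorffOp {η : Rn n → ℝ} (hη : IsWindow η) (k : Fin n → ℤ)
    (f : 𝓢(Rn n, ℂ)) :
    IsGivenBy (boxOp η k (hausdorffOp hΦ f)) fun x =>
      hausdorffOp hΦ f (compSubConstCLM ℂ x (𝓕 (hη.partitionSchwartz k))) := by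
  set K : 𝓢(Rn n, ℂ) := 𝓕 (hη.partitionSchwartz k)
  intro G
  have hprod := hΦ.integrable_prod_mul_translate_mul_hausdorffFun f G K
  have hinner : ∀ x, G x * hausdorffOp hΦ f (compSubConstCLM ℂ x K) =
      ∫ t, G x * (compSubConstCLM ℂ x K t * hausdorffFun Φ f t) := fun x => by
    rw [integral_const_mul]
    rfl
  simp only [hinner]
  refine ⟨hprod.integral_prod_left, ?_⟩
  have hconv : ∀ t, 𝓕 (smulLeftCLM ℂ (hη.partitionSchwartz k) (𝓕⁻ G : 𝓢(Rn n, ℂ))) t =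
      ∫ s, K (t - s) * G s := fun t => by
    rw [fourier_smulLeft_apply, FourierTransform.fourier_fourierInv_eq]
  calc boxOp η k (hausdorffOp hΦ f) G
      = ∫ t, 𝓕 (smulLeftCLM ℂ (hη.partitionSchwartz k) (𝓕⁻ G : 𝓢(Rn n, ℂ))) t *
          hausdorffFun Φ f t := by
        conv_lhs =>
          rw [← FourierTransform.fourier_fourierInv_eq (F := 𝓢(Rn n, ℂ)) G, boxOp_apply_fourier]
        rfl
    _ = ∫ t, ∫ s, G s * (compSubConstCLM ℂ s K t * hausdorffFun Φ f t) := by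
        simp only [hconv, ← integral_mul_const, compSubConstCLM_apply, mul_comm (K _), mul_assoc]
    _ = _ := by rw [← integral_prod_symm _ hprod, integral_prod _ hprod]

end IsHausdorffKernel

/-! ### Pairings of a translate with a slowly varying function -/

theorem min_one_pow {r : ℝ} (hr : 0 ≤ r) (d : ℕ) : min 1 (r ^ d) = min 1 r ^ d := by
  rcases le_total 1 r with h | h
  · rw [min_eq_left h, min_eq_left (one_le_pow₀ h), one_pow]
  · rw [min_eq_right h, min_eq_right (pow_le_one₀ hr h)]

theorem min_one_mul_inv_one_add_div_le {c N s A : ℝ} (hc : 0 < c) (hN : 0 < N) (hs : 0 < s)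
    (hA : c * N ≤ A) :
    min 1 (s * N) * (1 + A / (1 + s * N))⁻¹ ≤ max 1 (2 / c) * min 1 s := by
  have hA₀ : 0 < A := (mul_pos hc hN).trans_le hA
  rw [mul_min_of_nonneg _ _ (by positivity), mul_one]
  refine le_min ?_ ?_
  · exact (mul_le_one₀ (min_le_left _ _) (by positivity)
      (inv_le_one_of_one_le₀ (le_add_of_nonneg_right (by positivity)))).trans (le_max_left _ _)
  · have hmin : min 1 (s * N) * (1 + s * N) ≤ 2 * (s * N) := by
      rcases le_total 1 (s * N) with h | h
      · rw [min_eq_left h]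
        linarith
      · rw [min_eq_right h]
        nlinarith [mul_pos hs hN]
    calc min 1 (s * N) * (1 + A / (1 + s * N))⁻¹
        ≤ min 1 (s * N) * (A / (1 + s * N))⁻¹ := by
          gcongr
          exact le_add_of_nonneg_left zero_le_one
      _ = min 1 (s * N) * (1 + s * N) / A := by rw [inv_div, mul_div_assoc]
      _ ≤ 2 * (s * N) / (c * N) := by gcongr
      _ = 2 / c * s := by field_simp
      _ ≤ max 1 (2 / c) * s := by
          gcongr
          exact le_max_right _ _

theorem eventually_mul_le_norm_of_tendsto_inv_smul {E ι : Type*} [NormedAddCommGroup E]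
    [NormedSpace ℝ E] {l : Filter ι} {N : ι → ℝ} {a : ι → E} {z : E} (hN : ∀ j, 0 < N j)
    (hz : z ≠ 0) (ha : Tendsto (fun j => (N j)⁻¹ • a j) l (𝓝 z)) :
    ∀ᶠ j in l, ‖z‖ / 2 * N j ≤ ‖a j‖ := by
  filter_upwards [ha.norm.eventually_const_lt (half_lt_self (norm_pos_iff.2 hz))] with j hj
  rw [norm_smul, norm_inv, Real.norm_of_nonneg (hN j).le, lt_inv_mul_iff₀ (hN j)] at hj
  linarith

theorem tendsto_norm_atTop_of_tendsto_inv_smul {E ι : Type*} [NormedAddCommGroup E]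
    [NormedSpace ℝ E] {l : Filter ι} {N : ι → ℝ} {a : ι → E} {z : E} (hN₀ : ∀ j, 0 < N j)
    (hN : Tendsto N l atTop) (hz : z ≠ 0) (ha : Tendsto (fun j => (N j)⁻¹ • a j) l (𝓝 z)) :
    Tendsto (fun j => ‖a j‖) l atTop :=
  tendsto_atTop_mono' l (eventually_mul_le_norm_of_tendsto_inv_smul hN₀ hz ha)
    (hN.const_mul_atTop (half_pos (norm_pos_iff.2 hz)))

section Pairing

variable {E : Type*} [NormedAddCommGroup E] [InnerProductSpace ℝ E] [FiniteDimensional ℝ E]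
  [MeasurableSpace E] [BorelSpace E]

theorem exists_norm_integral_translate_mul_dilate_le (g w : 𝓢(E, ℂ)) {c : ℝ} (hc : 0 < c) :
    ∃ C : ℝ, ∀ (N s : ℝ) (a : E), 0 < N → 0 < s → c * N ≤ ‖a‖ →
      ‖∫ x, g (x - a) * w (N⁻¹ • s⁻¹ • x)‖ ≤ C * min 1 (s ^ Module.finrank ℝ E) := by
  set d := Module.finrank ℝ E
  obtain ⟨C₁, hC₁, hw⟩ := exists_decay w (d + 1 + d)
  obtain ⟨C₂, hC₂, hg⟩ := exists_decay_compSubConst g (d + 1 + d)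
  have hJ := japaneseIntegral_nonneg E
  refine ⟨C₁ * C₂ * japaneseIntegral E * max 1 (2 / c) ^ d, fun N s a hN hs ha => ?_⟩
  have hdecay := integral_norm_mul_norm_comp_inv_smul_le (A := w) (a := 0) (by simpa using hw)
    (hg a) (mul_pos hs hN)
  calc ‖∫ x, g (x - a) * w (N⁻¹ • s⁻¹ • x)‖
      ≤ ∫ x, ‖g (x - a)‖ * ‖w ((s * N)⁻¹ • x)‖ := by
        refine (norm_integral_le_integral_norm _).trans_eq ?_
        simp only [norm_mul, smul_smul, mul_inv_rev]
    _ ≤ C₁ * C₂ * japaneseIntegral E *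
          (min 1 ((s * N) ^ d) * ((1 + ‖a‖ / (1 + s * N)) ^ d)⁻¹) := by
        simpa only [compSubConstCLM_apply, smul_zero, sub_zero] using hdecay
    _ ≤ C₁ * C₂ * japaneseIntegral E * (max 1 (2 / c) * min 1 s) ^ d := by
        rw [min_one_pow (by positivity), ← inv_pow, ← mul_pow]
        gcongr ?_ * ?_ ^ d
        exact min_one_mul_inv_one_add_div_le hc hN hs ha
    _ = C₁ * C₂ * japaneseIntegral E * max 1 (2 / c) ^ d * min 1 (s ^ d) := by
        rw [mul_pow, min_one_pow hs.le, ← mul_assoc]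

variable {ι : Type*} {l : Filter ι} [l.IsCountablyGenerated] {N : ι → ℝ} {a : ι → E} {z : E}

theorem tendsto_integral_translate_mul_dilate (g w : 𝓢(E, ℂ)) (hN : Tendsto N l atTop)
    (ha : Tendsto (fun j => (N j)⁻¹ • a j) l (𝓝 z)) (t : ℝ) :
    Tendsto (fun j => ∫ x, g (x - a j) * w ((N j)⁻¹ • t • x)) l
      (𝓝 ((∫ x, g x) * w (t • z))) := by
  have hshift : ∀ j, ∫ x, g (x - a j) * w ((N j)⁻¹ • t • x) =
      ∫ x, g x * w ((N j)⁻¹ • t • (x + a j)) := fun j => by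
    rw [← integral_add_right_eq_self (fun x => g (x - a j) * w ((N j)⁻¹ • t • x)) (a j)]
    simp only [add_sub_cancel_right]
  simp only [hshift, ← integral_mul_const]
  refine tendsto_integral_filter_of_dominated_convergence
    (fun x => ‖g x‖ * SchwartzMap.seminorm ℂ 0 0 w) (Eventually.of_forall fun j => ?_)
    (Eventually.of_forall fun j => Eventually.of_forall fun x => ?_)
    (g.integrable.norm.mul_const _) (Eventually.of_forall fun x => ?_)
  · exact (g.continuous.mul (w.continuous.comp (by fun_prop))).aestronglyMeasurable
  · rw [norm_mul]
    gcongr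
    exact norm_le_seminorm ℂ w _
  · refine ((w.continuous.tendsto _).comp ?_).const_mul _
    have hlim := (((tendsto_inv_atTop_zero.comp hN).smul_const x).add ha).const_smul t
    simpa only [Function.comp_apply, zero_smul, zero_add, ← smul_add, smul_comm t] using hlim

theorem tendsto_integral_mul_integral_translate_mul_dilate {X : Type*} [MeasurableSpace X]
    {μ : Measure X} {ψ : X → ℂ} {s : X → ℝ} (hψ : AEStronglyMeasurable ψ μ) (hs : Measurable s)
    (hs₀ : ∀ᵐ y ∂μ, 0 < s y)
    (hψs : Integrable (fun y => min 1 (s y ^ Module.finrank ℝ E) * ‖ψ y‖) μ) (g w : 𝓢(E, ℂ))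
    (hN₀ : ∀ j, 0 < N j) (hN : Tendsto N l atTop) (hz : z ≠ 0)
    (ha : Tendsto (fun j => (N j)⁻¹ • a j) l (𝓝 z)) :
    Tendsto (fun j => ∫ y, ψ y * (∫ x, g (x - a j) * w ((N j)⁻¹ • (s y)⁻¹ • x)) ∂μ) l
      (𝓝 ((∫ x, g x) * ∫ y, ψ y * w ((s y)⁻¹ • z) ∂μ)) := by
  obtain ⟨C, hC⟩ := exists_norm_integral_translate_mul_dilate_le g w
    (half_pos (norm_pos_iff.2 hz))
  simp only [← integral_const_mul (∫ x, g x)]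
  refine tendsto_integral_filter_of_dominated_convergence
    (fun y => C * (min 1 (s y ^ Module.finrank ℝ E) * ‖ψ y‖)) (Eventually.of_forall fun j => ?_)
    ?_ (hψs.const_mul C) ?_
  · have hmeas : Measurable fun v : X × E => g (v.2 - a j) * w ((N j)⁻¹ • (s v.1)⁻¹ • v.2) :=
      (g.continuous.measurable.comp (by fun_prop)).mul (w.continuous.measurable.comp (by fun_prop))
    exact hψ.mul hmeas.stronglyMeasurable.integral_prod_right'.aestronglyMeasurable
  · filter_upwards [eventually_mul_le_norm_of_tendsto_inv_smul hN₀ hz ha] with j hj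
    filter_upwards [hs₀] with y hy
    rw [norm_mul, ← mul_assoc, mul_comm ‖ψ y‖]
    gcongr
    exact hC _ _ _ (hN₀ j) hy hj
  · refine Eventually.of_forall fun y => ?_
    rw [mul_left_comm]
    exact (tendsto_integral_translate_mul_dilate g w hN ha (s y)⁻¹).const_mul _

end Pairing

/-- The transpose `x ↦ ∫ Φ(y) |y|ⁿ w(|y| x) dy` of the Hausdorff operator, applied to `w`. -/
def hausdorffTranspose {n : ℕ} (Φ : Rn n → ℂ) (w : Rn n → ℂ) (x : Rn n) : ℂ :=
  ∫ y, Φ y * (‖y‖ ^ n : ℝ) * w (‖y‖ • x)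

namespace IsHausdorffKernel

variable {n : ℕ} [NeZero n] {Φ : Rn n → ℂ} (hΦ : IsHausdorffKernel Φ)
include hΦ

theorem hausdorffOp_apply_eq_integral_comp_smul (f w : 𝓢(Rn n, ℂ)) :
    hausdorffOp hΦ f w = ∫ y, Φ y * (‖y‖ ^ n : ℝ) * ∫ x, f x * w (‖y‖ • x) := by
  rw [hΦ.hausdorffOp_apply]
  refine integral_congr_ae ?_
  filter_upwards [ae_ne_zero] with y hy
  rw [integral_eq_pow_smul_integral_comp_smul _ (norm_pos_iff.2 hy), finrank_euclideanSpace_fin,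
    mul_assoc, Complex.real_smul]
  simp only [inv_smul_smul₀ (norm_ne_zero_iff.2 hy), mul_comm (w _)]

theorem integrable_prod_mul_comp_smul (f w : 𝓢(Rn n, ℂ)) :
    Integrable (fun v : Rn n × Rn n => f v.1 * (Φ v.2 * (‖v.2‖ ^ n : ℝ) * w (‖v.2‖ • v.1)))
      (volume.prod volume) := by
  have hmeas : AEStronglyMeasurable (fun v : Rn n × Rn n =>
      f v.1 * (Φ v.2 * (‖v.2‖ ^ n : ℝ) * w (‖v.2‖ • v.1))) (volume.prod volume) :=
    (f.continuous.comp continuous_fst).aestronglyMeasurable.mul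
      ((hΦ.aestronglyMeasurable.comp_snd.mul
        (Continuous.aestronglyMeasurable (by fun_prop))).mul
        (w.continuous.comp (by fun_prop)).aestronglyMeasurable)
  rw [integrable_prod_iff' hmeas]
  refine ⟨Eventually.of_forall fun y => ?_, ?_⟩
  · have hcont : Continuous fun x : Rn n => w (‖y‖ • x) :=
      w.continuous.comp (continuous_const_smul _)
    refine f.integrable.mul_bdd (g := fun x => Φ y * (‖y‖ ^ n : ℝ) * w (‖y‖ • x))
      (c := ‖Φ y * (‖y‖ ^ n : ℝ)‖ * SchwartzMap.seminorm ℂ 0 0 w)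
      (hcont.aestronglyMeasurable.const_mul _)
      (Eventually.of_forall fun x => (norm_mul_le _ _).trans ?_)
    gcongr
    exact norm_le_seminorm ℂ w _
  · refine (hΦ.integrable_prod f w).norm.integral_prod_right.congr ?_
    filter_upwards [ae_ne_zero] with y hy
    rw [integral_eq_pow_smul_integral_comp_smul _ (norm_pos_iff.2 hy),
      finrank_euclideanSpace_fin, ← integral_smul]
    simp only [inv_smul_smul₀ (norm_ne_zero_iff.2 hy), norm_mul, Complex.norm_real, norm_pow,
      norm_norm, smul_eq_mul]
    congr 1 with x
    ring

theorem hausdorffOp_apply_eq_integral_mul_hausdorffTranspose (f w : 𝓢(Rn n, ℂ)) :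
    hausdorffOp hΦ f w = ∫ x, f x * hausdorffTranspose Φ w x := by
  have hint := hΦ.integrable_prod_mul_comp_smul f w
  calc hausdorffOp hΦ f w
      = ∫ y, ∫ x, f x * (Φ y * (‖y‖ ^ n : ℝ) * w (‖y‖ • x)) := by
        rw [hΦ.hausdorffOp_apply_eq_integral_comp_smul]
        simp only [← integral_const_mul, mul_left_comm (f _)]
    _ = ∫ x, ∫ y, f x * (Φ y * (‖y‖ ^ n : ℝ) * w (‖y‖ • x)) := by
        rw [← integral_prod_symm _ hint, integral_prod _ hint]
    _ = ∫ x, f x * hausdorffTranspose Φ w x := by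
        simp only [integral_const_mul, hausdorffTranspose]

variable {ι : Type*} {l : Filter ι} [l.IsCountablyGenerated] {N : ι → ℝ} {a : ι → Rn n}
  {z : Rn n}

theorem tendsto_hausdorffOp_dilate_apply_translate (g w : 𝓢(Rn n, ℂ)) (hN₀ : ∀ j, 0 < N j)
    (hN : Tendsto N l atTop) (hz : z ≠ 0) (ha : Tendsto (fun j => (N j)⁻¹ • a j) l (𝓝 z)) :
    Tendsto (fun j => hausdorffOp hΦ (dilate (N j)⁻¹ (inv_pos.2 (hN₀ j)).ne' w)
      (compSubConstCLM ℂ (a j) g)) l (𝓝 ((∫ x, g x) * hausdorffFun Φ w z)) := by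
  simp only [hΦ.hausdorffOp_apply, dilate_apply, compSubConstCLM_apply]
  refine tendsto_integral_mul_integral_translate_mul_dilate (μ := volume)
    hΦ.aestronglyMeasurable measurable_norm ?_ ?_ g w hN₀ hN hz ha
  · filter_upwards [ae_ne_zero] with y hy using norm_pos_iff.2 hy
  · simp only [finrank_euclideanSpace_fin]
    exact hΦ.integrable_kernelWeight

theorem tendsto_hausdorffOp_translate_apply_dilate (g w : 𝓢(Rn n, ℂ)) (hN₀ : ∀ j, 0 < N j)
    (hN : Tendsto N l atTop) (hz : z ≠ 0) (ha : Tendsto (fun j => (N j)⁻¹ • a j) l (𝓝 z)) :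
    Tendsto (fun j => hausdorffOp hΦ (compSubConstCLM ℂ (a j) g)
      (dilate (N j)⁻¹ (inv_pos.2 (hN₀ j)).ne' w)) l
      (𝓝 ((∫ x, g x) * hausdorffTranspose Φ w z)) := by
  simp only [hΦ.hausdorffOp_apply_eq_integral_comp_smul, dilate_apply, compSubConstCLM_apply]
  have hlim := tendsto_integral_mul_integral_translate_mul_dilate
    (μ := volume) (ψ := fun y => Φ y * (‖y‖ ^ n : ℝ)) (s := fun y => ‖y‖⁻¹)
    (hΦ.aestronglyMeasurable.mul (Continuous.aestronglyMeasurable (by fun_prop)))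
    measurable_norm.inv ?_ (hΦ.integrable_kernelWeight.congr ?_) g w hN₀ hN hz ha
  · simp only [inv_inv] at hlim
    exact hlim
  · filter_upwards [ae_ne_zero] with y hy using inv_pos.2 (norm_pos_iff.2 hy)
  · filter_upwards [ae_ne_zero] with y hy
    have hy' : 0 < ‖y‖ ^ n := pow_pos (norm_pos_iff.2 hy) n
    rw [kernelWeight, finrank_euclideanSpace_fin, norm_mul, Complex.norm_real,
      Real.norm_of_nonneg hy'.le, mul_comm ‖Φ y‖, ← mul_assoc, min_mul_of_nonneg _ _ hy'.le,
      inv_pow, inv_mul_cancel₀ hy'.ne', one_mul, min_comm]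

end IsHausdorffKernel

/-! ### Vanishing of pairings -/

section Interpolation

theorem le_rpow_mul_rpow_of_le {x y δ : ℝ≥0∞} {s : ℝ} (hs₀ : 0 ≤ s) (hs₁ : s ≤ 1) (hδ : x ≤ δ)
    (hy : x ≤ y) : x ≤ δ ^ (1 - s) * y ^ s :=
  calc x = x ^ (1 - s) * x ^ s := by
        rw [← ENNReal.rpow_add_of_nonneg _ _ (sub_nonneg.2 hs₁) hs₀, sub_add_cancel,
          ENNReal.rpow_one]
    _ ≤ δ ^ (1 - s) * y ^ s := by
        gcongr

theorem lintegral_enorm_le_iSup_rpow_mul_eLpNorm_rpow {α E : Type*} [MeasurableSpace α]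
    {μ : Measure α} [NormedAddCommGroup E] {h : α → E} (hh : AEStronglyMeasurable h μ) {p : ℝ≥0∞}
    (hp₀ : 0 < p) (hp₁ : p ≤ 1) :
    ∫⁻ x, ‖h x‖ₑ ∂μ ≤ (⨆ x, ‖h x‖ₑ) ^ (1 - p.toReal) * eLpNorm h p μ ^ p.toReal := by
  have hp_top : p ≠ ⊤ := (hp₁.trans_lt ENNReal.one_lt_top).ne
  have hp : 0 < p.toReal := ENNReal.toReal_pos hp₀.ne' hp_top
  rw [eLpNorm_eq_lintegral_rpow_enorm_toReal hp₀.ne' hp_top, ← ENNReal.rpow_mul,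
    one_div_mul_cancel hp.ne', ENNReal.rpow_one,
    ← lintegral_const_mul'' _ (hh.enorm.pow_const _)]
  exact lintegral_mono fun x => le_rpow_mul_rpow_of_le hp.le
    (ENNReal.toReal_mono ENNReal.one_ne_top hp₁) (le_iSup (fun x => ‖h x‖ₑ) x) le_rfl

theorem tendsto_zero_of_enorm_le_rpow_mul {ι E : Type*} [NormedAddCommGroup E] {l : Filter ι}
    {u : ι → E} {δ : ι → ℝ≥0∞} {M : ℝ≥0∞} {s : ℝ} (hδ : Tendsto δ l (𝓝 0)) (hs : 0 < s)
    (hM : M ≠ ⊤) (hu : ∀ᶠ j in l, ‖u j‖ₑ ≤ δ j ^ s * M) : Tendsto u l (𝓝 0) := by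
  have hupper : Tendsto (fun j => δ j ^ s * M) l (𝓝 0) := by
    have h := ENNReal.Tendsto.mul_const (hδ.ennrpow_const s) (Or.inr hM)
    rwa [ENNReal.zero_rpow_of_pos hs, zero_mul] at h
  exact tendsto_zero_iff_enorm_tendsto_zero.2 <|
    tendsto_of_tendsto_of_tendsto_of_le_of_le' tendsto_const_nhds hupper
      (Eventually.of_forall fun _ => zero_le) hu

theorem IsGivenBy.enorm_apply_le_iSup_rpow_mul {n : ℕ} {u : 𝓢'(Rn n, ℂ)} {h : Rn n → ℂ}
    (hu : IsGivenBy u h) {p : ℝ≥0∞} (hp₀ : 0 < p) (hp₁ : p ≤ 1) {g : 𝓢(Rn n, ℂ)} {M : ℝ≥0∞}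
    (hg : ∀ x, ‖g x‖ₑ ≤ M) :
    ‖u g‖ₑ ≤ (⨆ x, ‖h x‖ₑ) ^ (1 - p.toReal) * (distLpNorm p u ^ p.toReal * M) := by
  calc ‖u g‖ₑ = ‖∫ x, g x * h x‖ₑ := by rw [(hu g).2]
    _ ≤ ∫⁻ x, ‖g x * h x‖ₑ := enorm_integral_le_lintegral_enorm _
    _ ≤ ∫⁻ x, M * ‖h x‖ₑ := by
        simp only [enorm_mul]
        gcongr with x
        exact hg x
    _ = M * ∫⁻ x, ‖h x‖ₑ :=
        lintegral_const_mul'' _ hu.locallyIntegrable.aestronglyMeasurable.enorm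
    _ ≤ M * ((⨆ x, ‖h x‖ₑ) ^ (1 - p.toReal) * distLpNorm p u ^ p.toReal) := by
        rw [hu.distLpNorm_eq]
        gcongr
        exact lintegral_enorm_le_iSup_rpow_mul_eLpNorm_rpow
          hu.locallyIntegrable.aestronglyMeasurable hp₀ hp₁
    _ = _ := by ring

end Interpolation

/-- A bump on the frequency side, the Fourier transform of a band-limited profile. It is supported
in `|ξ| ≤ 1 / 4`, where `partitionFun η 0 = 1` for every window `η`. -/
def frequencyBump (n : ℕ) : 𝓢(Rn n, ℂ) :=
  bumpSchwartz (c := 0) ⟨1 / 8, 1 / 4, by norm_num, by norm_num⟩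

theorem norm_le_of_frequencyBump_ne_zero {n : ℕ} {ξ : Rn n} (h : frequencyBump n ξ ≠ 0) :
    ‖ξ‖ ≤ 1 / 4 :=
  (mem_ball_zero_iff.1 (mem_ball_of_bumpSchwartz_ne_zero h)).le

theorem integral_frequencyBump_ne_zero (n : ℕ) : ∫ ξ, frequencyBump n ξ ≠ 0 :=
  integral_bumpSchwartz_ne_zero _

theorem integral_fourierInv_frequencyBump (n : ℕ) :
    ∫ x, (𝓕⁻ (frequencyBump n) : 𝓢(Rn n, ℂ)) x = 1 := by
  have hone : frequencyBump n 0 = 1 :=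
    bumpSchwartz_eq_one _ (Metric.mem_closedBall_self (by norm_num))
  rw [← FourierTransform.fourier_fourierInv_eq (F := 𝓢(Rn n, ℂ)) (frequencyBump n), fourier_coe,
    Real.fourier_eq] at hone
  simpa using hone

theorem eLpNorm_compSubConst {n : ℕ} (f : 𝓢(Rn n, ℂ)) (a : Rn n) (p : ℝ≥0∞) :
    eLpNorm (compSubConstCLM ℂ a f) p volume = eLpNorm f p volume :=
  eLpNorm_comp_measurePreserving (g := (f : Rn n → ℂ)) f.continuous.aestronglyMeasurable
    (measurePreserving_sub_right volume a)

theorem exists_norm_le_of_hasCompactSupport {E F : Type*} [NormedAddCommGroup E] [Zero F]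
    {f : E → F} (hf : HasCompactSupport f) : ∃ R : ℝ, ∀ x, f x ≠ 0 → ‖x‖ ≤ R := by
  obtain ⟨R, hR⟩ := hf.isCompact.isBounded.subset_closedBall 0
  exact ⟨R, fun x hx => mem_closedBall_zero_iff.1 (hR (subset_tsupport f hx))⟩

namespace IsWindow

variable {n : ℕ} {η : Rn n → ℝ} (hη : IsWindow η)
include hη

theorem boxOp_apply_fourier_eq_self {k : Fin n → ℤ} {V : 𝓢(Rn n, ℂ)}
    (hV : ∀ ξ, V ξ ≠ 0 → ‖ξ - latticePoint k‖ ≤ 1 / 4) (u : 𝓢'(Rn n, ℂ)) :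
    boxOp η k u (𝓕 V) = u (𝓕 V) := by
  rw [boxOp_apply_fourier, hη.smulLeft_partitionFun_eq_self hV]

theorem boxOp_zero_apply_dilate_fourier (u : 𝓢'(Rn n, ℂ)) {W : 𝓢(Rn n, ℂ)} {R : ℝ}
    (hR : ∀ ξ, W ξ ≠ 0 → ‖ξ‖ ≤ R) {N : ℝ} (hN : 0 < N) (hRN : 4 * R ≤ N) :
    boxOp η 0 u (dilate N⁻¹ (inv_pos.2 hN).ne' (𝓕 W)) =
      u (dilate N⁻¹ (inv_pos.2 hN).ne' (𝓕 W)) := by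
  rw [← fourier_pow_smul_dilate hN]
  refine hη.boxOp_apply_fourier_eq_self (fun ξ hξ => ?_) u
  rw [smul_apply, dilate_apply] at hξ
  have hle := hR _ (right_ne_zero_of_smul hξ)
  rw [norm_smul, Real.norm_of_nonneg hN.le] at hle
  rw [latticePoint_zero, sub_zero]
  by_contra! hcon
  nlinarith

theorem modulationNorm_translate_fourierInv_frequencyBump (p : ℝ≥0∞) {q : ℝ≥0∞} (hq : 0 < q)
    (a : Rn n) :
    modulationNorm η p q (toTemperedDistributionCLM (Rn n) ℂ volume
      (compSubConstCLM ℂ a (𝓕⁻ (frequencyBump n)))) =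
      eLpNorm (𝓕⁻ (frequencyBump n) : 𝓢(Rn n, ℂ)) p volume := by
  rw [hη.modulationNorm_eq_of_fourier_support p hq (k := 0), eLpNorm_compSubConst]
  intro ξ hξ
  rw [← norm_ne_zero_iff, norm_fourier_compSubConst_apply,
    FourierTransform.fourier_fourierInv_eq, norm_ne_zero_iff] at hξ
  rw [latticePoint_zero, sub_zero]
  exact norm_le_of_frequencyBump_ne_zero hξ

theorem modulationNorm_fourierInv_translate_frequencyBump (p : ℝ≥0∞) {q : ℝ≥0∞} (hq : 0 < q)
    (k : Fin n → ℤ) :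
    modulationNorm η p q (toTemperedDistributionCLM (Rn n) ℂ volume
      (𝓕⁻ (compSubConstCLM ℂ (latticePoint k) (frequencyBump n)))) =
      eLpNorm (𝓕⁻ (frequencyBump n) : 𝓢(Rn n, ℂ)) p volume := by
  rw [hη.modulationNorm_eq_of_fourier_support p hq (k := k)]
  · exact eLpNorm_congr_norm_ae
      (Eventually.of_forall fun x => norm_fourierInv_compSubConst_apply _ _ x)
  · intro ξ hξ
    rw [FourierTransform.fourier_fourierInv_eq, compSubConstCLM_apply] at hξ
    exact norm_le_of_frequencyBump_ne_zero hξ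

end IsWindow

namespace IsHausdorffKernel

variable {n : ℕ} [NeZero n] {Φ : Rn n → ℂ} (hΦ : IsHausdorffKernel Φ)
include hΦ

theorem tendsto_iSup_enorm_hausdorffOp_apply {ι κ : Type*} {l : Filter ι} {f g : ι → κ → 𝓢(Rn n, ℂ)}
    {a b : ι → κ → Rn n} {C₁ C₂ : ℝ} {r : ι → ℝ}
    (hf : ∀ j k t, (1 + ‖t - a j k‖) ^ (n + 2) * ‖f j k t‖ ≤ C₁)
    (hg : ∀ j k t, (1 + ‖t - b j k‖) ^ (n + 2) * ‖g j k t‖ ≤ C₂)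
    (hr : Tendsto r l atTop) (hab : ∀ j k, r j ≤ ‖a j k‖ + ‖b j k‖) :
    Tendsto (fun j => ⨆ k, ‖hausdorffOp hΦ (f j k) (g j k)‖ₑ) l (𝓝 0) := by
  set A := C₁ * C₂ * japaneseIntegral (Rn n)
  refine ENNReal.tendsto_nhds_zero.2 fun ε hε => ?_
  obtain ⟨ε', hε'₀, hε'⟩ := ENNReal.lt_iff_exists_nnreal_btwn.1 hε
  have hε'₀ : (0 : ℝ) < ε' := mod_cast hε'₀
  obtain ⟨L, hL⟩ := hΦ.exists_concentration_le (ε := ε' / (|A| + 1)) (by positivity)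
  filter_upwards [hr.eventually_ge_atTop L] with j hj
  refine iSup_le fun k => le_trans ?_ hε'.le
  rw [← ofReal_norm, ← ENNReal.ofReal_coe_nnreal]
  refine ENNReal.ofReal_le_ofReal ?_
  calc ‖hausdorffOp hΦ (f j k) (g j k)‖
      ≤ A * concentration Φ (a j k) (b j k) := hΦ.norm_hausdorffOp_apply_le (hf j k) (hg j k)
    _ ≤ (|A| + 1) * (ε' / (|A| + 1)) :=
        mul_le_mul ((le_abs_self A).trans (le_add_of_nonneg_right zero_le_one))
          (hL _ _ (hj.trans (hab j k))) (concentration_nonneg Φ _ _) (by positivity)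
    _ = ε' := mul_div_cancel₀ _ (by positivity)

theorem hausdorffOp_eq_zero_of_forall_apply_fourier {W : 𝓢(Rn n, ℂ)}
    (h : ∀ f : 𝓢(Rn n, ℂ), hausdorffOp hΦ f (𝓕 W) = 0) : hausdorffOp hΦ W = 0 := by
  ext g
  have hg := h (𝓕⁻ g)
  rwa [hΦ.hausdorffOp_apply_fourier, FourierTransform.fourier_fourierInv_eq] at hg

theorem tendsto_iSup_enorm_hausdorffOp_translate (f K : 𝓢(Rn n, ℂ)) {ι : Type*} {l : Filter ι}
    {a : ι → Rn n} (ha : Tendsto (fun j => ‖a j‖) l atTop) :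
    Tendsto (fun j => ⨆ x, ‖hausdorffOp hΦ (compSubConstCLM ℂ (a j) f)
      (compSubConstCLM ℂ x K)‖ₑ) l (𝓝 0) := by
  obtain ⟨C₁, -, hf⟩ := exists_decay_compSubConst f (n + 2)
  obtain ⟨C₂, -, hK⟩ := exists_decay_compSubConst K (n + 2)
  exact hΦ.tendsto_iSup_enorm_hausdorffOp_apply (fun j _ => hf (a j)) (fun _ x => hK x) ha
    fun _ _ => le_add_of_nonneg_right (norm_nonneg _)

/-! ### The case `p < 1` -/

section Left

variable {η : Rn n → ℝ} {p q : ℝ≥0∞}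

theorem tendsto_hausdorffOp_translate_apply_dilate_zero (hη : IsWindow η) (hp₀ : 0 < p)
    (hp₁ : p < 1) (hq : 0 < q) (hb : IsBoundedOnModulation η p q (hausdorffOp hΦ))
    {W : 𝓢(Rn n, ℂ)} (hW : HasCompactSupport W) {ι : Type*} {l : Filter ι} {N : ι → ℝ}
    {a : ι → Rn n} (hN₀ : ∀ j, 0 < N j) (hN : Tendsto N l atTop)
    (ha : Tendsto (fun j => ‖a j‖) l atTop) :
    Tendsto (fun j => hausdorffOp hΦ (compSubConstCLM ℂ (a j) (𝓕⁻ (frequencyBump n)))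
      (dilate (N j)⁻¹ (inv_pos.2 (hN₀ j)).ne' (𝓕 W))) l (𝓝 0) := by
  obtain ⟨C, hC⟩ := hb
  obtain ⟨R, hR⟩ := exists_norm_le_of_hasCompactSupport hW
  set β : 𝓢(Rn n, ℂ) := 𝓕⁻ (frequencyBump n)
  have hM : (C * eLpNorm β p volume) ^ p.toReal *
      ENNReal.ofReal (SchwartzMap.seminorm ℂ 0 0 (𝓕 W)) ≠ ⊤ :=
    ENNReal.mul_ne_top (ENNReal.rpow_ne_top_of_nonneg ENNReal.toReal_nonneg
      (ENNReal.mul_ne_top ENNReal.coe_ne_top (β.memLp p volume).eLpNorm_ne_top))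
      ENNReal.ofReal_ne_top
  have hp : p.toReal < 1 := ENNReal.toReal_lt_of_lt_ofReal (by simpa using hp₁)
  refine tendsto_zero_of_enorm_le_rpow_mul
    (hΦ.tendsto_iSup_enorm_hausdorffOp_translate β (𝓕 (hη.partitionSchwartz 0)) ha)
    (sub_pos.2 hp) hM ?_
  filter_upwards [hN.eventually_ge_atTop (4 * R)] with j hj
  rw [← hη.boxOp_zero_apply_dilate_fourier _ hR (hN₀ j) hj]
  refine ((hΦ.isGivenBy_boxOp_hausdorffOp hη 0 _).enorm_apply_le_iSup_rpow_mul hp₀ hp₁.le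
    (M := ENNReal.ofReal (SchwartzMap.seminorm ℂ 0 0 (𝓕 W))) fun x => ?_).trans ?_
  · rw [← ofReal_norm, dilate_apply]
    exact ENNReal.ofReal_le_ofReal (norm_le_seminorm ℂ (𝓕 W) _)
  · gcongr
    rw [← hη.modulationNorm_translate_fourierInv_frequencyBump p hq (a j)]
    exact (distLpNorm_boxOp_le_modulationNorm η p hq 0 _).trans (hC _)

theorem eq_zero_of_isBoundedOnModulation_of_lt_one_left (hη : IsWindow η) (hp₀ : 0 < p)
    (hp₁ : p < 1) (hq : 0 < q) (hb : IsBoundedOnModulation η p q (hausdorffOp hΦ)) :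
    hausdorffOp hΦ = 0 := by
  have hN : Tendsto (fun j : ℕ => (j + 1 : ℝ)) atTop atTop :=
    tendsto_atTop_add_const_right _ _ tendsto_natCast_atTop_atTop
  have hN₀ : ∀ j : ℕ, (0 : ℝ) < j + 1 := fun j => by positivity
  refine hΦ.hausdorffOp_eq_zero_of_compactSupport fun W hW => ?_
  have htranspose : ∀ z, z ≠ 0 → hausdorffTranspose Φ (𝓕 W : 𝓢(Rn n, ℂ)) z = 0 := by
    intro z hz
    have hmean : Tendsto (fun j : ℕ => (j + 1 : ℝ)⁻¹ • (j + 1 : ℝ) • z) atTop (𝓝 z) := by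
      simp only [inv_smul_smul₀ (hN₀ _).ne', tendsto_const_nhds]
    have hlim := hΦ.tendsto_hausdorffOp_translate_apply_dilate (𝓕⁻ (frequencyBump n)) (𝓕 W) hN₀ hN
      hz hmean
    rw [integral_fourierInv_frequencyBump, one_mul] at hlim
    exact tendsto_nhds_unique hlim
      (hΦ.tendsto_hausdorffOp_translate_apply_dilate_zero hη hp₀ hp₁ hq hb hW hN₀ hN
        (tendsto_norm_atTop_of_tendsto_inv_smul hN₀ hN hz hmean))
  refine hΦ.hausdorffOp_eq_zero_of_forall_apply_fourier fun f => ?_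
  rw [hΦ.hausdorffOp_apply_eq_integral_mul_hausdorffTranspose]
  refine integral_eq_zero_of_ae ?_
  filter_upwards [ae_ne_zero] with x hx
  rw [htranspose x hx, mul_zero, Pi.zero_apply]

end Left

end IsHausdorffKernel

/-! ### The case `q < 1 ≤ p` -/

section FourierPiece

variable {E : Type*} [NormedAddCommGroup E] [InnerProductSpace ℝ E] [FiniteDimensional ℝ E]
  [MeasurableSpace E] [BorelSpace E]

theorem integrable_one_add_norm_pow_mul_norm (f : 𝓢(E, ℂ)) (k : ℕ) :
    Integrable fun x => (1 + ‖x‖) ^ k * ‖f x‖ := by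
  obtain ⟨C, -, hC⟩ := exists_decay f (k + (Module.finrank ℝ E + 1))
  have hint := (integrable_japanese_sub (0 : E)).const_mul C
  simp only [sub_zero] at hint
  refine hint.mono' ?_
    (Eventually.of_forall fun x => ?_)
  · exact (Continuous.mul (by fun_prop) f.continuous.norm).aestronglyMeasurable
  · rw [Real.norm_of_nonneg (by positivity), ← div_eq_mul_inv, le_div_iff₀ (by positivity)]
    calc _ = (1 + ‖x‖) ^ (k + (Module.finrank ℝ E + 1)) * ‖f x‖ := by ring
      _ ≤ C := hC x

theorem integral_one_add_norm_pow_mul_norm_fourier_dilate_le (f : 𝓢(E, ℂ)) (k : ℕ) {c : ℝ}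
    (hc : 0 < c) (hc₁ : c ≤ 1) :
    ∫ x, (1 + ‖x‖) ^ k * ‖𝓕 (dilate c hc.ne' f) x‖ ≤ ∫ x, (1 + ‖x‖) ^ k * ‖𝓕 f x‖ := by
  calc ∫ x, (1 + ‖x‖) ^ k * ‖𝓕 (dilate c hc.ne' f) x‖
      = ∫ x, (1 + ‖c • x‖) ^ k * ‖𝓕 f x‖ := by
        rw [integral_eq_pow_smul_integral_comp_smul _ hc, ← integral_smul]
        simp only [fourier_dilate_apply hc, inv_smul_smul₀ hc.ne', norm_smul, norm_inv, norm_pow,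
          Real.norm_of_nonneg hc.le, smul_eq_mul]
        congr 1 with x
        field_simp
    _ ≤ ∫ x, (1 + ‖x‖) ^ k * ‖𝓕 f x‖ := by
        refine integral_mono_of_nonneg (Eventually.of_forall fun x => by positivity)
          (integrable_one_add_norm_pow_mul_norm (𝓕 f) k) (Eventually.of_forall fun x => ?_)
        simp only [norm_smul, Real.norm_of_nonneg hc.le]
        gcongr
        exact mul_le_of_le_one_left (norm_nonneg _) hc₁

theorem exists_norm_fourier_translate_smulLeft_le (χ : 𝓢(E, ℂ)) (k : ℕ) :
    ∃ C : ℝ, 0 ≤ C ∧ ∀ (a : E) (V : 𝓢(E, ℂ)) (x : E),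
      ‖𝓕 (smulLeftCLM ℂ (compSubConstCLM ℂ a χ) V) x‖ ≤
        C * (∫ s, (1 + ‖s‖) ^ k * ‖𝓕 V s‖) * ((1 + ‖x‖) ^ k)⁻¹ := by
  obtain ⟨C, hC₀, hC⟩ := exists_decay (𝓕 χ) k
  refine ⟨C, hC₀, fun a V x => ?_⟩
  have hpeetre : ∀ s, 1 + ‖x‖ ≤ (1 + ‖x - s‖) * (1 + ‖s‖) := fun s => by
    nlinarith [norm_le_norm_sub_add x s, mul_nonneg (norm_nonneg (x - s)) (norm_nonneg s)]
  have hbound : ∀ s, ‖𝓕 (compSubConstCLM ℂ a χ) (x - s) * 𝓕 V s‖ ≤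
      C * ((1 + ‖s‖) ^ k * ‖𝓕 V s‖) * ((1 + ‖x‖) ^ k)⁻¹ := fun s => by
    rw [← div_eq_mul_inv, le_div_iff₀ (by positivity), norm_mul, norm_fourier_compSubConst_apply]
    calc ‖𝓕 χ (x - s)‖ * ‖𝓕 V s‖ * (1 + ‖x‖) ^ k
        ≤ ‖𝓕 χ (x - s)‖ * ‖𝓕 V s‖ * ((1 + ‖x - s‖) * (1 + ‖s‖)) ^ k := by
          gcongr
          exact hpeetre s
      _ = (1 + ‖x - s‖) ^ k * ‖𝓕 χ (x - s)‖ * ((1 + ‖s‖) ^ k * ‖𝓕 V s‖) := by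
          rw [mul_pow]
          ring
      _ ≤ C * ((1 + ‖s‖) ^ k * ‖𝓕 V s‖) := by
          gcongr
          exact hC _
  rw [fourier_smulLeft_apply, ← integral_const_mul, ← integral_mul_const]
  exact norm_integral_le_of_norm_le
    (((integrable_one_add_norm_pow_mul_norm (𝓕 V) k).const_mul C).mul_const _)
    (Eventually.of_forall hbound)

theorem exists_eLpNorm_fourier_translate_smulLeft_dilate_le (χ W : 𝓢(E, ℂ)) (p : ℝ≥0∞) :
    ∃ B : ℝ≥0∞, B ≠ ⊤ ∧ ∀ (a : E) (c : ℝ) (hc : 0 < c), c ≤ 1 →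
      eLpNorm (𝓕 (smulLeftCLM ℂ (compSubConstCLM ℂ a χ) (dilate c hc.ne' W)) : 𝓢(E, ℂ)) p volume
        ≤ B := by
  obtain ⟨k, hk⟩ := Measure.HasTemperateGrowth.exists_eLpNorm_lt_top p
    (μ := (volume : Measure E)) inferInstance
  obtain ⟨C, hC₀, hC⟩ := exists_norm_fourier_translate_smulLeft_le χ k
  refine ⟨ENNReal.ofReal (C * ∫ s, (1 + ‖s‖) ^ k * ‖𝓕 W s‖) *
    eLpNorm (fun x : E => (1 + ‖x‖) ^ (-k : ℝ)) p volume,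
    ENNReal.mul_ne_top ENNReal.ofReal_ne_top hk.ne, fun a c hc hc₁ => ?_⟩
  refine eLpNorm_le_mul_eLpNorm_of_ae_le_mul (Eventually.of_forall fun x => ?_) p
  rw [Real.norm_of_nonneg (by positivity), Real.rpow_neg (by positivity), Real.rpow_natCast]
  refine (hC a _ x).trans ?_
  exact mul_le_mul_of_nonneg_right (mul_le_mul_of_nonneg_left
    (integral_one_add_norm_pow_mul_norm_fourier_dilate_le W k hc hc₁) hC₀) (by positivity)

end FourierPiece

/-- A cutoff equal to `1` on the ball of radius `n`, hence on the support of `partitionFun η 0` for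
every window `η`. -/
def boxCutoff (n : ℕ) : 𝓢(Rn n, ℂ) :=
  bumpSchwartz (c := 0) ⟨n + 1, n + 2, by positivity, by linarith⟩

theorem boxCutoff_eq_one {n : ℕ} {ξ : Rn n} (h : ‖ξ‖ ≤ n) : boxCutoff n ξ = 1 :=
  bumpSchwartz_eq_one _ <| mem_closedBall_zero_iff.2 <| h.trans <|
    le_add_of_nonneg_right zero_le_one

namespace IsWindow

variable {n : ℕ} {η : Rn n → ℝ} (hη : IsWindow η)
include hη

theorem boxOp_apply_fourier_boxCutoff_smulLeft (k : Fin n → ℤ) (u : 𝓢'(Rn n, ℂ)) (V : 𝓢(Rn n, ℂ)) :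
    boxOp η k u (𝓕 (smulLeftCLM ℂ (compSubConstCLM ℂ (latticePoint k) (boxCutoff n)) V)) =
      boxOp η k u (𝓕 V) := by
  rw [boxOp_apply_fourier, boxOp_apply_fourier]
  congr 2
  ext ξ
  rw [smulLeftCLM_apply_apply (hη.hasTemperateGrowth_partitionFun k),
    smulLeftCLM_apply_apply (hη.hasTemperateGrowth_partitionFun k),
    smulLeftCLM_apply_apply (hasTemperateGrowth _), compSubConstCLM_apply]
  by_cases h : partitionFun η k ξ = 0
  · simp [h]
  · rw [boxCutoff_eq_one (hη.norm_sub_le_of_partitionFun_ne_zero h), one_smul]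

theorem exists_finset_sum_partitionFun_eq_one (R : ℝ) :
    ∃ S : Finset (Fin n → ℤ), ∀ ξ, ‖ξ‖ ≤ R → ∑ k ∈ S, partitionFun η k ξ = 1 := by
  refine ⟨(finite_lattice_near (0 : Rn n) (R + 1)).toFinset, fun ξ hξ => ?_⟩
  refine (tsum_eq_sum fun k hk => ?_).symm.trans (hη.tsum_partitionFun ξ)
  by_contra hne
  refine hk ((Set.Finite.mem_toFinset _).2 fun i => ?_)
  have hnear := abs_lt.1 (hη.abs_sub_lt_of_partitionFun_ne_zero hne i)
  have hcoord := abs_le.1 ((abs_apply_le_norm ξ i).trans hξ)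
  rw [PiLp.zero_apply, zero_sub, abs_neg, abs_le]
  constructor <;> linarith

theorem exists_finset_sum_boxOp_apply_fourier {V : 𝓢(Rn n, ℂ)} (hV : HasCompactSupport V) :
    ∃ S : Finset (Fin n → ℤ), ∀ u : 𝓢'(Rn n, ℂ), u (𝓕 V) = ∑ k ∈ S, boxOp η k u (𝓕 V) := by
  obtain ⟨R, hR⟩ := exists_norm_le_of_hasCompactSupport hV
  obtain ⟨S, hS⟩ := hη.exists_finset_sum_partitionFun_eq_one R
  have hsum : ∑ k ∈ S, smulLeftCLM ℂ (fun ξ => (partitionFun η k ξ : ℂ)) V = V := by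
    ext ξ
    simp only [sum_apply, smulLeftCLM_apply_apply (hη.hasTemperateGrowth_partitionFun _)]
    rw [← Finset.sum_smul, ← Complex.ofReal_sum]
    by_cases h : V ξ = 0
    · rw [h, smul_zero]
    · rw [hS ξ (hR ξ h), Complex.ofReal_one, one_smul]
  refine ⟨S, fun u => ?_⟩
  simp only [boxOp_apply_fourier]
  rw [← map_sum, ← FourierTransform.fourier_sum, hsum]

theorem enorm_apply_fourier_le {p p' q : ℝ≥0∞} [p.HolderConjugate p'] (hq₀ : 0 < q) (hq₁ : q ≤ 1)
    (u : 𝓢'(Rn n, ℂ)) {V : 𝓢(Rn n, ℂ)} (hV : HasCompactSupport V) {B : ℝ≥0∞}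
    (hB : ∀ a, eLpNorm (𝓕 (smulLeftCLM ℂ (compSubConstCLM ℂ a (boxCutoff n)) V) : 𝓢(Rn n, ℂ))
      p' volume ≤ B) :
    ‖u (𝓕 V)‖ₑ ≤ (⨆ k, ‖boxOp η k u (𝓕 V)‖ₑ) ^ (1 - q.toReal) *
      (modulationNorm η p q u * B) ^ q.toReal := by
  have hq_top : q ≠ ⊤ := (hq₁.trans_lt ENNReal.one_lt_top).ne
  obtain ⟨S, hS⟩ := hη.exists_finset_sum_boxOp_apply_fourier hV
  have hbox : ∀ k, ‖boxOp η k u (𝓕 V)‖ₑ ≤ distLpNorm p (boxOp η k u) * B := fun k => by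
    rw [← hη.boxOp_apply_fourier_boxCutoff_smulLeft]
    exact (enorm_apply_le_distLpNorm_mul_eLpNorm (p' := p') _ _).trans (by gcongr; exact hB _)
  calc ‖u (𝓕 V)‖ₑ ≤ ∑ k ∈ S, ‖boxOp η k u (𝓕 V)‖ₑ := by
        rw [hS u]
        exact enorm_sum_le _ _
    _ ≤ ∑ k ∈ S, (⨆ k, ‖boxOp η k u (𝓕 V)‖ₑ) ^ (1 - q.toReal) *
          (distLpNorm p (boxOp η k u) * B) ^ q.toReal :=
        Finset.sum_le_sum fun k _ => le_rpow_mul_rpow_of_le ENNReal.toReal_nonneg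
          (ENNReal.toReal_mono ENNReal.one_ne_top hq₁)
          (le_iSup (fun k => ‖boxOp η k u (𝓕 V)‖ₑ) k) (hbox k)
    _ = (⨆ k, ‖boxOp η k u (𝓕 V)‖ₑ) ^ (1 - q.toReal) *
          ((∑ k ∈ S, distLpNorm p (boxOp η k u) ^ q.toReal) * B ^ q.toReal) := by
        simp only [ENNReal.mul_rpow_of_nonneg _ _ ENNReal.toReal_nonneg, Finset.mul_sum,
          Finset.sum_mul]
    _ ≤ _ := by
        rw [ENNReal.mul_rpow_of_nonneg _ _ ENNReal.toReal_nonneg]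
        gcongr
        exact sum_rpow_le_lqNorm_rpow hq₀ hq_top (fun k => distLpNorm p (boxOp η k u)) S

theorem one_add_norm_pow_mul_norm_partitionFun_smulLeft_dilate_le (k : Fin n → ℤ) (m : ℕ)
    (W : 𝓢(Rn n, ℂ)) (c : ℝ) (hc : c ≠ 0) (t : Rn n) :
    (1 + ‖t - latticePoint k‖) ^ m *
      ‖smulLeftCLM ℂ (fun ξ => (partitionFun η k ξ : ℂ)) (dilate c hc W) t‖ ≤
      (1 + n) ^ m * SchwartzMap.seminorm ℂ 0 0 W := by
  rw [smulLeftCLM_apply_apply (hη.hasTemperateGrowth_partitionFun k), dilate_apply, norm_smul,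
    Complex.norm_real, Real.norm_of_nonneg (hη.partitionFun_nonneg k t)]
  by_cases h : partitionFun η k t = 0
  · rw [h, zero_mul, mul_zero]
    positivity
  · have hnear := hη.norm_sub_le_of_partitionFun_ne_zero h
    have hW : partitionFun η k t * ‖W (c • t)‖ ≤ SchwartzMap.seminorm ℂ 0 0 W :=
      (mul_le_of_le_one_left (norm_nonneg _) (hη.partitionFun_le_one k t)).trans
        (norm_le_seminorm ℂ W _)
    exact mul_le_mul (by gcongr) hW
      (mul_nonneg (hη.partitionFun_nonneg k t) (norm_nonneg _)) (by positivity)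

end IsWindow

/-- The lattice point `⌊x⌋`, coordinatewise. -/
def latticeFloor {n : ℕ} (x : Rn n) : Fin n → ℤ := fun i => ⌊x i⌋

theorem norm_latticeFloor_sub_le {n : ℕ} (x : Rn n) : ‖latticePoint (latticeFloor x) - x‖ ≤ n := by
  refine (norm_le_mul_of_forall_abs_le (c := 1) fun i => ?_).trans_eq (mul_one _)
  rw [PiLp.sub_apply, latticePoint_apply, latticeFloor, abs_sub_comm, Int.self_sub_floor,
    abs_of_nonneg (Int.fract_nonneg _)]
  exact (Int.fract_lt_one _).le

theorem tendsto_inv_smul_latticeFloor {n : ℕ} {ι : Type*} {l : Filter ι} {N : ι → ℝ}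
    (hN₀ : ∀ j, 0 < N j) (hN : Tendsto N l atTop) (z : Rn n) :
    Tendsto (fun j => (N j)⁻¹ • (latticePoint (latticeFloor (N j • z)) : Rn n)) l (𝓝 z) := by
  rw [tendsto_iff_norm_sub_tendsto_zero]
  have hbound : Tendsto (fun j => (N j)⁻¹ * (n : ℝ)) l (𝓝 0) := by
    simpa only [Function.comp_apply, zero_mul] using (tendsto_inv_atTop_zero.comp hN).mul_const _
  refine squeeze_zero (fun _ => norm_nonneg _) (fun j => ?_) hbound
  calc ‖(N j)⁻¹ • latticePoint (latticeFloor (N j • z)) - z‖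
      = (N j)⁻¹ * ‖latticePoint (latticeFloor (N j • z)) - N j • z‖ := by
        rw [← norm_smul_of_nonneg (inv_pos.2 (hN₀ j)).le, smul_sub, inv_smul_smul₀ (hN₀ j).ne']
    _ ≤ (N j)⁻¹ * n :=
        mul_le_mul_of_nonneg_left (norm_latticeFloor_sub_le _) (inv_pos.2 (hN₀ j)).le

namespace IsHausdorffKernel

variable {n : ℕ} [NeZero n] {Φ : Rn n → ℂ} (hΦ : IsHausdorffKernel Φ)
include hΦ

theorem hausdorffOp_fourierInv_apply_fourier (f g : 𝓢(Rn n, ℂ)) :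
    hausdorffOp hΦ (𝓕⁻ g) (𝓕 f) = hausdorffOp hΦ f g := by
  rw [hΦ.hausdorffOp_apply_fourier, FourierTransform.fourier_fourierInv_eq]

section Right

variable {η : Rn n → ℝ} {p q : ℝ≥0∞}

theorem tendsto_iSup_enorm_boxOp_hausdorffOp_fourierInv_translate (hη : IsWindow η)
    (g W : 𝓢(Rn n, ℂ)) {ι : Type*} {l : Filter ι} {c : ι → ℝ} (hc : ∀ j, c j ≠ 0) {a : ι → Rn n}
    (ha : Tendsto (fun j => ‖a j‖) l atTop) :
    Tendsto (fun j => ⨆ k, ‖boxOp η k (hausdorffOp hΦ (𝓕⁻ (compSubConstCLM ℂ (a j) g)))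
      (𝓕 (dilate (c j) (hc j) W))‖ₑ) l (𝓝 0) := by
  obtain ⟨C, -, hg⟩ := exists_decay_compSubConst g (n + 2)
  simp only [boxOp_apply_fourier, hΦ.hausdorffOp_fourierInv_apply_fourier]
  exact hΦ.tendsto_iSup_enorm_hausdorffOp_apply
    (fun j k => hη.one_add_norm_pow_mul_norm_partitionFun_smulLeft_dilate_le k (n + 2) W _ (hc j))
    (fun j _ => hg (a j)) ha fun _ _ => le_add_of_nonneg_left (norm_nonneg _)

theorem tendsto_hausdorffOp_dilate_apply_translate_zero (hη : IsWindow η) (hp : 1 ≤ p)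
    (hq₀ : 0 < q) (hq₁ : q < 1) (hb : IsBoundedOnModulation η p q (hausdorffOp hΦ))
    {W : 𝓢(Rn n, ℂ)} (hW : HasCompactSupport W) {ι : Type*} {l : Filter ι} {N : ι → ℝ}
    {k : ι → Fin n → ℤ} (hN₀ : ∀ j, 0 < N j) (hN : Tendsto N l atTop)
    (hk : Tendsto (fun j => ‖(latticePoint (k j) : Rn n)‖) l atTop) :
    Tendsto (fun j => hausdorffOp hΦ (dilate (N j)⁻¹ (inv_pos.2 (hN₀ j)).ne' W)
      (compSubConstCLM ℂ (latticePoint (k j)) (frequencyBump n))) l (𝓝 0) := by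
  obtain ⟨C, hC⟩ := hb
  have hconj : p.HolderConjugate p.conjExponent := .conjExponent hp
  obtain ⟨B, hB_top, hB⟩ :=
    exists_eLpNorm_fourier_translate_smulLeft_dilate_le (boxCutoff n) W p.conjExponent
  set β : 𝓢(Rn n, ℂ) := 𝓕⁻ (frequencyBump n)
  have hM : (C * eLpNorm β p volume * B) ^ q.toReal ≠ ⊤ :=
    ENNReal.rpow_ne_top_of_nonneg ENNReal.toReal_nonneg <| ENNReal.mul_ne_top
      (ENNReal.mul_ne_top ENNReal.coe_ne_top (β.memLp p volume).eLpNorm_ne_top) hB_top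
  have hq : q.toReal < 1 := ENNReal.toReal_lt_of_lt_ofReal (by simpa using hq₁)
  refine tendsto_zero_of_enorm_le_rpow_mul
    (hΦ.tendsto_iSup_enorm_boxOp_hausdorffOp_fourierInv_translate hη (frequencyBump n) W
      (fun j => (inv_pos.2 (hN₀ j)).ne') hk) (sub_pos.2 hq) hM ?_
  filter_upwards [hN.eventually_ge_atTop 1] with j hj
  rw [← hΦ.hausdorffOp_fourierInv_apply_fourier]
  refine (hη.enorm_apply_fourier_le (p := p) (p' := p.conjExponent) hq₀ hq₁.le _
    (hasCompactSupport_dilate hW _ _)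
    fun a => hB a _ (inv_pos.2 (hN₀ j)) (inv_le_one_of_one_le₀ hj)).trans ?_
  gcongr
  rw [← hη.modulationNorm_fourierInv_translate_frequencyBump p hq₀ (k j)]
  exact hC _

theorem eq_zero_of_isBoundedOnModulation_of_lt_one_right (hη : IsWindow η) (hp : 1 ≤ p)
    (hq₀ : 0 < q) (hq₁ : q < 1) (hb : IsBoundedOnModulation η p q (hausdorffOp hΦ)) :
    hausdorffOp hΦ = 0 := by
  have hN : Tendsto (fun j : ℕ => (j + 1 : ℝ)) atTop atTop :=
    tendsto_atTop_add_const_right _ _ tendsto_natCast_atTop_atTop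
  have hN₀ : ∀ j : ℕ, (0 : ℝ) < j + 1 := fun j => by positivity
  refine hΦ.hausdorffOp_eq_zero_of_compactSupport fun W hW => ?_
  have hfun : ∀ z, z ≠ 0 → hausdorffFun Φ W z = 0 := by
    intro z hz
    have hfloor := tendsto_inv_smul_latticeFloor hN₀ hN z
    have hlim := tendsto_nhds_unique
      (hΦ.tendsto_hausdorffOp_dilate_apply_translate (frequencyBump n) W hN₀ hN hz hfloor)
      (hΦ.tendsto_hausdorffOp_dilate_apply_translate_zero hη hp hq₀ hq₁ hb hW hN₀ hN
        (tendsto_norm_atTop_of_tendsto_inv_smul hN₀ hN hz hfloor))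
    exact (mul_eq_zero.1 hlim).resolve_left (integral_frequencyBump_ne_zero n)
  ext g
  change ∫ x, g x * hausdorffFun Φ W x = 0
  refine integral_eq_zero_of_ae ?_
  filter_upwards [ae_ne_zero] with x hx
  rw [hfun x hx, mul_zero, Pi.zero_apply]

end Right

end IsHausdorffKernel

theorem HasBoundedExtension.isBoundedOnModulation {n : ℕ} {η : Rn n → ℝ} {p q : ℝ≥0∞}
    {H : 𝓢(Rn n, ℂ) →ₗ[ℂ] 𝓢'(Rn n, ℂ)} (h : HasBoundedExtension η p q H) :
    IsBoundedOnModulation η p q H := by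
  obtain ⟨T, hT, C, hC⟩ := h
  -- A nonzero constant is needed where the norm of `f` is infinite, as `0 * ∞ = 0`.
  refine ⟨C + 1, fun f => ?_⟩
  by_cases hf : MemModulation η p q (toTemperedDistributionCLM (Rn n) ℂ volume f)
  · rw [← hT]
    refine (hC _ hf).trans ?_
    gcongr
    exact le_self_add
  · rw [MemModulation, not_lt, top_le_iff] at hf
    rw [hf, ENNReal.mul_top (by simp)]
    exact le_top

theorem isBoundedOnModulation_zero {n : ℕ} (η : Rn n → ℝ) (p : ℝ≥0∞) {q : ℝ≥0∞} (hq : 0 < q) :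
    IsBoundedOnModulation η p q (0 : 𝓢(Rn n, ℂ) →ₗ[ℂ] 𝓢'(Rn n, ℂ)) :=
  ⟨0, fun f => by simp [modulationNorm_zero η p hq]⟩

theorem hasBoundedExtension_zero {n : ℕ} (η : Rn n → ℝ) (p : ℝ≥0∞) {q : ℝ≥0∞} (hq : 0 < q) :
    HasBoundedExtension η p q (0 : 𝓢(Rn n, ℂ) →ₗ[ℂ] 𝓢'(Rn n, ℂ)) :=
  ⟨0, fun _ => by simp, 0, fun u _ => by simp [modulationNorm_zero η p hq]⟩

end HausdorffModulation

end

theorem mainTheorem5 {n : ℕ} [NeZero n] (p q : ℝ≥0∞) (hp : 0 < p) (hq : 0 < q)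
    (hpq : p < 1 ∨ q < 1)
    (η : HausdorffModulation.Rn n → ℝ) (hη : HausdorffModulation.IsWindow η)
    (Φ : HausdorffModulation.Rn n → ℂ) (hΦ : HausdorffModulation.IsHausdorffKernel Φ) :
    (HausdorffModulation.IsBoundedOnModulation η p q (HausdorffModulation.hausdorffOp hΦ) ↔
      HausdorffModulation.hausdorffOp hΦ = 0) ∧
    (HausdorffModulation.HasBoundedExtension η p q (HausdorffModulation.hausdorffOp hΦ) ↔
      HausdorffModulation.hausdorffOp hΦ = 0) := by
  have hmain : HausdorffModulation.IsBoundedOnModulation η p q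
      (HausdorffModulation.hausdorffOp hΦ) → HausdorffModulation.hausdorffOp hΦ = 0 := by
    intro hb
    by_cases hp1 : p < 1
    · exact hΦ.eq_zero_of_isBoundedOnModulation_of_lt_one_left hη hp hp1 hq hb
    · exact hΦ.eq_zero_of_isBoundedOnModulation_of_lt_one_right hη (not_lt.1 hp1) hq
        (hpq.resolve_left hp1) hb
  refine ⟨⟨hmain, fun h => ?_⟩, fun h => hmain h.isBoundedOnModulation, fun h => ?_⟩
  · rw [h]
    exact HausdorffModulation.isBoundedOnModulation_zero η p hq
  · rw [h]
    exact HausdorffModulation.hasBoundedExtension_zero η p hq
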